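/- **Data.** Let $\mathcal N$ (buses) and $\mathcal G$ (generators) be finite sets, $\mathcal T=\{1,\dots,T\}$ with $T\ge 1$, $\mathcal L\subseteq\mathcal N\times\mathcal N$ (lines), $\mathcal L^R$ the reversed lines, and $\mathcal G_k$ the set of generators at bus $k$. Given are real costs $C^p_g,C^u_g,C^v_g,C^z_g$, real limits $P_g^{\min},P_g^{\max},Q_g^{\min},Q_g^{\max},R^U_g,R^D_g$, times $\Delta_g^{Up},\Delta_g^{Down}\in\mathbb N$, complex demands $D_{kt}$, voltage limits $V_k^{\min}\ge 0$ and $V_k^{\max}$, thermal limits $S^{\max}_{ij}$, and admittances $Y_{ij}=G_{ij}+\mathbf jB_{ij}$, $(i,j)\in\mathcal L$. **The problem $\mathcal{AC}$.** Minimize $\sum_{g,t}(C^p_gp_{gt}+C^u_gu_{gt}+C^v_gv_{gt}+C^z_gz_{gt})$ over complex generation $s_{gt}=p_{gt}+\mathbf jq_{gt}$, complex flows $s_{ijt}=p_{ijt}+\mathbf jq_{ijt}$ for $(i,j)\in\mathcal L\cup\mathcal L^R$, complex voltages $\nu_{kt}$ and binaries $u_{gt},v_{gt},z_{gt}$, subject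 to - $\sum_{g\in\mathcal G_k}s_{gt}-\sum_{(k,j)\in\mathcal L\cup\mathcal L^R}s_{kjt}=D_{kt}$ for all $k,t$; - $s_{ijt}=\nu_{it}(\overline{\nu_{it}}-\overline{\nu_{jt}})\overline{Y_{ij}}$ and $s_{jit}=\nu_{jt}(\overline{\nu_{jt}}-\overline{\nu_{it}})\overline{Y_{ij}}$ for $(i,j)\in\mathcal L$; $V^{\min}_k\le|\nu_{kt}|\le V^{\max}_k$; $|s_{ijt}|^2\le(S^{\max}_{ij})^2$ for $(i,j)\in\mathcal L\cup\mathcal L^R$; - for all $g,t$: $P^{\min}_gz_{gt}\le p_{gt}\le P^{\max}_gz_{gt}$, $Q^{\min}_gz_{gt}\le q_{gt}\le Q^{\max}_gz_{gt}$, $p_{gt}\ge0$; - for all $g$ and $t\ge2$: $u_{gt}-v_{gt}=z_{gt}-z_{g,t-1}$, $p_{gt}-p_{g,t-1}\le R^U_gz_{g,t-1}+P^{\min}_gu_{gt}$, $p_{g,t-1}-p_{gt}\le R^D_gz_{gt}+P^{\min}_gv_{gt}$, $\sum_{\tau=\max(1,t-\Delta^{Up}_g)}^tu_{g\tau}\le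 z_{gt}$, $\sum_{\tau=\max(1,t-\Delta^{Down}_g)}^tv_{g\tau}\le1-z_{gt}$. **The lifted vector.** Put $p^{Loss}_t=\sum_k\sum_{(k,j)\in\mathcal L\cup\mathcal L^R}p_{kjt}$. Let $x$ be the vector of the variables $u_{gt},v_{gt},z_{gt}$ (index set $\mathcal B$), $p_{gt}$, $q_{gt}$, $p^{Loss}_t$, and one slack for each inequality among the last two groups of constraints other than $p_{gt}\ge0$, and for each of $u_{gt},v_{gt},z_{gt}\le1$. Since $x$ is to be nonnegative, fix any set $\mathcal S$ of the quantities $q_{gt},p^{Loss}_t$ such that every quantity outside $\mathcal S$ is nonnegative at all feasible points of $\mathcal{AC}$ (e.g. let $\mathcal S$ contain all of them); each quantity in $\mathcal S$ is entered in $x$ as a difference of two nonnegative variables, each other one as a single variable. Let $a_e^\top x=b_e$ be the resulting equality constraints (with slacks), and $h_t^\top x=\sum_gp_{gt}-p^{Loss}_t$. Let $U_i$ ($i\notin\mathcal B$) be numbers with $x_i\le U_i$ at all feasible points of $\mathcal{AC}$ (with the slacks, and with the positive and negative parts of the quantities in $\mathcal S$, computed from the point); this is the standing assumption that continuous variables are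 bounded. **The relaxation $\mathcal{AC}^{SDP}$.** Minimize the same linear objective over real $p_{ijt},q_{ijt}$ ($(i,j)\in\mathcal L\cup\mathcal L^R$), symmetric $W_t=\begin{bmatrix}W^R_t&W^C_t\\W_t^{C\top}&W^I_t\end{bmatrix}\succeq0$ of order $2|\mathcal N|$, and symmetric $Y=\begin{bmatrix}1&x^\top\\x&X\end{bmatrix}\succeq0$, $Y\ge0$ entrywise, subject to - $p_{ijt}^2+q_{ijt}^2\le(S^{\max}_{ij})^2$; $(V^{\min}_k)^2\le W^R_{kkt}+W^I_{kkt}\le(V^{\max}_k)^2$; - for $(i,j)\in\mathcal L$: $p_{ijt}=G_{ij}(W^R_{iit}+W^I_{iit})-G_{ij}(W^R_{ijt}+W^I_{ijt})-B_{ij}(W^C_{jit}-W^C_{ijt})$, $q_{ijt}=-B_{ij}(W^R_{iit}+W^I_{iit})+B_{ij}(W^R_{ijt}+W^I_{ijt})-G_{ij}(W^C_{jit}-W^C_{ijt})$, $p_{jit}=G_{ij}(W^R_{jjt}+W^I_{jjt})-G_{ij}(W^R_{ijt}+W^I_{ijt})-B_{ij}(W^C_{ijt}-W^C_{jit})$,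 $q_{jit}=-B_{ij}(W^R_{jjt}+W^I_{jjt})+B_{ij}(W^R_{ijt}+W^I_{ijt})-G_{ij}(W^C_{ijt}-W^C_{jit})$; - the real and imaginary parts of the bus balance equations, and the loss equations $p_t^{Loss}=\sum_k\sum_{(k,j)\in\mathcal L\cup\mathcal L^R}p_{kjt}$; - $a_e^\top x=b_e$ and $\mathrm{Tr}(a_ea_e^\top X)=b_e^2$ for all $e$; $\mathrm{Tr}(h_th_t^\top X)=(\sum_k\mathrm{Re}\,D_{kt})^2$ for all $t$; $x_i=X_{ii}$ for $i\in\mathcal B$; $X_{ii}\le U_i^2$ for $i\notin\mathcal B$. Its dual is the conic Lagrangian dual, with one multiplier for each constraint: free for equations (including $Y_{00}=1$), of the appropriate sign for scalar inequalities, in the second-order cone for the thermal limits, positive semidefinite for $W_t\succeq0$ and $Y\succeq0$, and symmetric entrywise nonnegative for $Y\ge0$. **Proposition.** If $\mathcal{AC}$ is feasible, then strong duality holds between $\mathcal{AC}^{SDP}$ and its dual: both are feasible, the minimum of $\mathcal{AC}^{SDP}$ is attained, and it equals the supremum of the dual objective over the dual feasible set. -/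

import Mathlib

/-!
The alternating-current unit commitment problem (ACUC), its semidefinite relaxation, and the conic
dual of that relaxation.
-/

open scoped Matrix

noncomputable section

/-- Data of an ACUC instance with buses `N`, generators `G` and `n + 1` time periods `0, …, n`. -/
structure ACUC (N G : Type*) (n : ℕ) where
  /-- transmission lines, as ordered pairs of buses -/
  L : Finset (N × N)
  /-- the bus at which a generator is located -/
  bus : G → N
  /-- production cost -/
  Cp : G → ℝ
  /-- startup cost -/
  Cu : G → ℝ
  /-- shutdown cost -/
  Cv : G → ℝ
  /-- fixed cost of being on -/
  Cz : G → ℝ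
  /-- real production limits -/
  Pmin : G → ℝ
  Pmax : G → ℝ
  /-- reactive production limits -/
  Qmin : G → ℝ
  Qmax : G → ℝ
  /-- ramping limits -/
  RU : G → ℝ
  RD : G → ℝ
  /-- minimum up and down times -/
  upTime : G → ℕ
  downTime : G → ℕ
  /-- complex demand -/
  demand : N → Fin (n + 1) → ℂ
  /-- voltage magnitude limits -/
  Vmin : N → ℝ
  Vmax : N → ℝ
  /-- complex admittance of the line `(i, j)`; only its values on `L` are used -/
  adm : N → N → ℂ
  /-- thermal limits; only the values on `L` and on the reversed lines are used -/
  Smax : N → N → ℝ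

namespace ACUC

/-- The time window `max(first, t - d), …, t` of the minimum up and down time constraints. -/
def window {n : ℕ} (t : Fin (n + 1)) (d : ℕ) : Finset (Fin (n + 1)) :=
  Finset.univ.filter fun r => r ≤ t ∧ (t : ℕ) ≤ (r : ℕ) + d

section Network

variable {N G : Type*} [Fintype N] [DecidableEq N] [Fintype G] {n : ℕ} (P : ACUC N G n)

/-- Directed lines: the lines and their reversals. -/
def arcSet : Finset (N × N) := P.L ∪ P.L.image Prod.swap

/-- The type of directed lines. -/
abbrev Arc : Type _ := { a : N × N // a ∈ P.arcSet }

/-- The line `(i, j)` as a directed line. -/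
def fwd (l : P.L) : P.Arc :=
  ⟨l.1, Finset.mem_union_left _ l.2⟩

/-- The reversal `(j, i)` of the line `(i, j)`. -/
def rev (l : P.L) : P.Arc :=
  ⟨l.1.swap, Finset.mem_union_right _ (Finset.mem_image_of_mem _ l.2)⟩

/-- Directed lines leaving the bus `k`. -/
def out (k : N) : Finset P.Arc := Finset.univ.filter fun a => a.1.1 = k

/-- Generators at the bus `k`. -/
def gensAt (k : N) : Finset G := Finset.univ.filter fun g => P.bus g = k

/-- A candidate solution of ACUC. -/
structure Sol where
  /-- complex power generation `p + j q` -/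
  gen : G → Fin (n + 1) → ℂ
  /-- startup, shutdown and on/off decisions -/
  u : G → Fin (n + 1) → ℝ
  v : G → Fin (n + 1) → ℝ
  z : G → Fin (n + 1) → ℝ
  /-- complex power flows -/
  flow : P.Arc → Fin (n + 1) → ℂ
  /-- complex voltages -/
  volt : N → Fin (n + 1) → ℂ

/-- The constraints of the mixed-integer nonlinear problem ACUC. For `s : Fin n`, the consecutive
periods `t - 1` and `t` are `s.castSucc` and `s.succ`. -/
structure Feasible (y : P.Sol) : Prop where
  balance : ∀ k t, ∑ g ∈ P.gensAt k, y.gen g t - ∑ a ∈ P.out k, y.flow a t = P.demand k t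
  flow_fwd : ∀ (l : P.L) t, y.flow (P.fwd l) t =
    y.volt l.1.1 t * (star (y.volt l.1.1 t) - star (y.volt l.1.2 t)) * star (P.adm l.1.1 l.1.2)
  flow_rev : ∀ (l : P.L) t, y.flow (P.rev l) t =
    y.volt l.1.2 t * (star (y.volt l.1.2 t) - star (y.volt l.1.1 t)) * star (P.adm l.1.1 l.1.2)
  volt_min : ∀ k t, P.Vmin k ≤ ‖y.volt k t‖
  volt_max : ∀ k t, ‖y.volt k t‖ ≤ P.Vmax k
  thermal : ∀ (a : P.Arc) t, ‖y.flow a t‖ ^ 2 ≤ P.Smax a.1.1 a.1.2 ^ 2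
  q_min : ∀ g t, P.Qmin g * y.z g t ≤ (y.gen g t).im
  q_max : ∀ g t, (y.gen g t).im ≤ P.Qmax g * y.z g t
  p_min : ∀ g t, P.Pmin g * y.z g t ≤ (y.gen g t).re
  p_max : ∀ g t, (y.gen g t).re ≤ P.Pmax g * y.z g t
  logic : ∀ g (s : Fin n), y.u g s.succ - y.v g s.succ = y.z g s.succ - y.z g s.castSucc
  ramp_up : ∀ g (s : Fin n), (y.gen g s.succ).re - (y.gen g s.castSucc).re ≤
    P.RU g * y.z g s.castSucc + P.Pmin g * y.u g s.succ
  ramp_down : ∀ g (s : Fin n), (y.gen g s.castSucc).re - (y.gen g s.succ).re ≤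
    P.RD g * y.z g s.succ + P.Pmin g * y.v g s.succ
  min_up : ∀ g (s : Fin n), ∑ r ∈ window s.succ (P.upTime g), y.u g r ≤ y.z g s.succ
  min_down : ∀ g (s : Fin n), ∑ r ∈ window s.succ (P.downTime g), y.v g r ≤ 1 - y.z g s.succ
  u_bin : ∀ g t, y.u g t = 0 ∨ y.u g t = 1
  v_bin : ∀ g t, y.v g t = 0 ∨ y.v g t = 1
  z_bin : ∀ g t, y.z g t = 0 ∨ y.z g t = 1
  p_nonneg : ∀ g t, 0 ≤ (y.gen g t).re

/-- Total real line loss at time `t`. -/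
def loss (y : P.Sol) (t : Fin (n + 1)) : ℝ := ∑ k, ∑ a ∈ P.out k, (y.flow a t).re

end Network

section Index

/-- The binary variables. -/
inductive Bin (G : Type*) (n : ℕ)
  | u (g : G) (t : Fin (n + 1))
  | v (g : G) (t : Fin (n + 1))
  | z (g : G) (t : Fin (n + 1))
  deriving DecidableEq, Fintype

/-- The inequalities among the unit commitment constraints; each of them gets a slack variable. -/
inductive Ineq (G : Type*) (n : ℕ)
  | pMin (g : G) (t : Fin (n + 1))
  | pMax (g : G) (t : Fin (n + 1))
  | qMin (g : G) (t : Fin (n + 1))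
  | qMax (g : G) (t : Fin (n + 1))
  | rampUp (g : G) (s : Fin n)
  | rampDown (g : G) (s : Fin n)
  | minUp (g : G) (s : Fin n)
  | minDown (g : G) (s : Fin n)
  | binUb (i : Bin G n)
  deriving DecidableEq, Fintype

/-- The real quantities of the unit commitment constraints that are not declared nonnegative in
ACUC: `inl (g, t)` is the reactive production `q g t`, and `inr t` is the total loss at `t`. -/
abbrev Quantity (G : Type*) (n : ℕ) : Type _ := (G × Fin (n + 1)) ⊕ Fin (n + 1)

/-- The nonnegative continuous variables of the lifting. A quantity outside `S` is one nonnegative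
variable `pos`; a quantity in `S` is signed, and is written as `pos - neg`. -/
inductive Cont (G : Type*) (n : ℕ) (S : Finset (Quantity G n))
  | p (g : G) (t : Fin (n + 1))
  | pos (f : Quantity G n)
  | neg (f : { f : Quantity G n // f ∈ S })
  | slack (r : Ineq G n)
  deriving DecidableEq, Fintype

/-- Indices of the vector `x` of all variables of the unit commitment constraints. -/
abbrev Idx (G : Type*) (n : ℕ) (S : Finset (Quantity G n)) : Type _ := Bin G n ⊕ Cont G n S

/-- The unit commitment constraints in equality form: `inl r` is the inequality `r` with its slack,
and `inr (g, s)` is the constraint that links startup, shutdown and status. -/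
abbrev Row (G : Type*) (n : ℕ) : Type _ := Ineq G n ⊕ (G × Fin n)

end Index

section Coefficients

variable {N G : Type*} [Fintype G] [DecidableEq G] {n : ℕ} (P : ACUC N G n)
  (S : Finset (Quantity G n))

/-- Coefficient vector of a startup variable. -/
def eU (g : G) (t : Fin (n + 1)) : Idx G n S → ℝ := Pi.single (Sum.inl (Bin.u g t)) 1

/-- Coefficient vector of a shutdown variable. -/
def eV (g : G) (t : Fin (n + 1)) : Idx G n S → ℝ := Pi.single (Sum.inl (Bin.v g t)) 1

/-- Coefficient vector of a status variable. -/
def eZ (g : G) (t : Fin (n + 1)) : Idx G n S → ℝ := Pi.single (Sum.inl (Bin.z g t)) 1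

/-- Coefficient vector of a real production variable. -/
def eP (g : G) (t : Fin (n + 1)) : Idx G n S → ℝ := Pi.single (Sum.inr (Cont.p g t)) 1

/-- Coefficient vector of a quantity: `pos`, or `pos - neg` if the quantity is signed. -/
def eF (f : Quantity G n) : Idx G n S → ℝ :=
  Pi.single (Sum.inr (Cont.pos f)) 1 -
    if h : f ∈ S then Pi.single (Sum.inr (Cont.neg ⟨f, h⟩)) 1 else 0

/-- Coefficient vector of a reactive production. -/
def eQ (g : G) (t : Fin (n + 1)) : Idx G n S → ℝ := eF S (Sum.inl (g, t))

/-- Coefficient vector of a total loss. -/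
def eLoss (t : Fin (n + 1)) : Idx G n S → ℝ := eF S (Sum.inr t)

/-- Coefficients of the inequality `r`, read as `ineqVec r ⬝ᵥ x ≤ ineqRhs r`. -/
def ineqVec : Ineq G n → Idx G n S → ℝ
  | .pMin g t => P.Pmin g • eZ S g t - eP S g t
  | .pMax g t => eP S g t - P.Pmax g • eZ S g t
  | .qMin g t => P.Qmin g • eZ S g t - eQ S g t
  | .qMax g t => eQ S g t - P.Qmax g • eZ S g t
  | .rampUp g s => eP S g s.succ - eP S g s.castSucc - P.RU g • eZ S g s.castSucc -
      P.Pmin g • eU S g s.succ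
  | .rampDown g s => eP S g s.castSucc - eP S g s.succ - P.RD g • eZ S g s.succ -
      P.Pmin g • eV S g s.succ
  | .minUp g s => ∑ r ∈ window s.succ (P.upTime g), eU S g r - eZ S g s.succ
  | .minDown g s => ∑ r ∈ window s.succ (P.downTime g), eV S g r + eZ S g s.succ
  | .binUb i => Pi.single (Sum.inl i) 1

/-- Right-hand side of the inequality `r`. -/
def ineqRhs : Ineq G n → ℝ
  | .minDown _ _ => 1
  | .binUb _ => 1
  | _ => 0

/-- The coefficient vectors `a` of the equality constraints `a ⬝ᵥ x = b`. -/
def rowVec : Row G n → Idx G n S → ℝ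
  | .inl r => P.ineqVec S r + Pi.single (Sum.inr (Cont.slack r)) 1
  | .inr (g, s) => eU S g s.succ - eV S g s.succ - eZ S g s.succ + eZ S g s.castSucc

/-- The right-hand sides `b` of the equality constraints `a ⬝ᵥ x = b`. -/
def rowRhs : Row G n → ℝ
  | .inl r => ineqRhs r
  | .inr _ => 0

/-- Coefficients of the aggregated real demand constraint: total real production minus loss. -/
def aggVec (t : Fin (n + 1)) : Idx G n S → ℝ := ∑ g, eP S g t - eLoss S t

/-- Right-hand side of the aggregated real demand constraint. -/
def aggRhs [Fintype N] (t : Fin (n + 1)) : ℝ := ∑ k, (P.demand k t).re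

/-- The objective as a function of the vector `x`. -/
def costOf (x : Idx G n S → ℝ) : ℝ :=
  ∑ g, ∑ t, (P.Cp g * x (Sum.inr (Cont.p g t)) + P.Cu g * x (Sum.inl (Bin.u g t)) +
    P.Cv g * x (Sum.inl (Bin.v g t)) + P.Cz g * x (Sum.inl (Bin.z g t)))

end Coefficients

section Bounds

variable {N G : Type*} [Fintype N] [DecidableEq N] [Fintype G] [DecidableEq G] {n : ℕ}
  (P : ACUC N G n) (S : Finset (Quantity G n))

/-- The value of a quantity at a solution of ACUC. -/
def quantity (y : P.Sol) : Quantity G n → ℝ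
  | .inl (g, t) => (y.gen g t).im
  | .inr t => P.loss y t

/-- The vector `x` of a solution of ACUC, with zeros in place of the slack variables; signed
quantities are split into positive and negative parts. -/
def preVec (y : P.Sol) : Idx G n S → ℝ
  | .inl (.u g t) => y.u g t
  | .inl (.v g t) => y.v g t
  | .inl (.z g t) => y.z g t
  | .inr (.p g t) => (y.gen g t).re
  | .inr (.pos f) => max (P.quantity y f) 0
  | .inr (.neg f) => max (-P.quantity y f.1) 0
  | .inr (.slack _) => 0

/-- The value of a continuous variable at a solution of ACUC. -/
def contVal (y : P.Sol) : Cont G n S → ℝ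
  | .slack r => ineqRhs r - P.ineqVec S r ⬝ᵥ P.preVec S y
  | i => P.preVec S y (Sum.inr i)

/-- `U` bounds the continuous variables: they are at most `U` at every feasible solution. -/
def BoundedBy (U : Cont G n S → ℝ) : Prop :=
  ∀ y, P.Feasible y → ∀ i, P.contVal S y i ≤ U i

/-- Every quantity that is not treated as signed is nonnegative at every feasible solution. -/
def NonnegOutside : Prop :=
  ∀ y, P.Feasible y → ∀ f, f ∉ S → 0 ≤ P.quantity y f

end Bounds

section Relaxation

variable {N G : Type*} [Fintype N] [DecidableEq N] [Fintype G] [DecidableEq G] {n : ℕ}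
  (P : ACUC N G n) (S : Finset (Quantity G n)) (U : Cont G n S → ℝ)

/-- The variables of the semidefinite relaxation. -/
structure Lift where
  /-- real and reactive power flows -/
  pf : P.Arc → Fin (n + 1) → ℝ
  qf : P.Arc → Fin (n + 1) → ℝ
  /-- the lifted voltages, with blocks `[W^R, W^C; (W^C)ᵀ, W^I]` -/
  W : Fin (n + 1) → Matrix (N ⊕ N) (N ⊕ N) ℝ
  /-- the lifted unit commitment variables, `Y = [1, xᵀ; x, X]`, with first index `none` -/
  Y : Matrix (Option (Idx G n S)) (Option (Idx G n S)) ℝ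

namespace Lift

variable {P S} (w : P.Lift S)

/-- The vector `x` in `Y`. -/
def x : Idx G n S → ℝ := fun i => w.Y (some i) none

/-- The matrix `X` in `Y`. -/
def X : Matrix (Idx G n S) (Idx G n S) ℝ := w.Y.submatrix some some

/-- The relaxed squared voltage magnitude `W^R_ii + W^I_ii`. -/
def sq (i : N) (t : Fin (n + 1)) : ℝ := w.W t (.inl i) (.inl i) + w.W t (.inr i) (.inr i)

/-- `W^R_ij + W^I_ij`. -/
def re (i j : N) (t : Fin (n + 1)) : ℝ := w.W t (.inl i) (.inl j) + w.W t (.inr i) (.inr j)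

/-- `W^C_ji - W^C_ij`. -/
def im (i j : N) (t : Fin (n + 1)) : ℝ := w.W t (.inl j) (.inr i) - w.W t (.inl i) (.inr j)

/-- Left side minus right side of the relaxed flow equation for `p_ij`. -/
def pFwd (l : P.L) (t : Fin (n + 1)) : ℝ :=
  w.pf (P.fwd l) t - ((P.adm l.1.1 l.1.2).re * w.sq l.1.1 t -
    (P.adm l.1.1 l.1.2).re * w.re l.1.1 l.1.2 t - (P.adm l.1.1 l.1.2).im * w.im l.1.1 l.1.2 t)

/-- Left side minus right side of the relaxed flow equation for `q_ij`. -/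
def qFwd (l : P.L) (t : Fin (n + 1)) : ℝ :=
  w.qf (P.fwd l) t - (-(P.adm l.1.1 l.1.2).im * w.sq l.1.1 t +
    (P.adm l.1.1 l.1.2).im * w.re l.1.1 l.1.2 t - (P.adm l.1.1 l.1.2).re * w.im l.1.1 l.1.2 t)

/-- Left side minus right side of the relaxed flow equation for `p_ji`. -/
def pRev (l : P.L) (t : Fin (n + 1)) : ℝ :=
  w.pf (P.rev l) t - ((P.adm l.1.1 l.1.2).re * w.sq l.1.2 t -
    (P.adm l.1.1 l.1.2).re * w.re l.1.1 l.1.2 t - (P.adm l.1.1 l.1.2).im * w.im l.1.2 l.1.1 t)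

/-- Left side minus right side of the relaxed flow equation for `q_ji`. -/
def qRev (l : P.L) (t : Fin (n + 1)) : ℝ :=
  w.qf (P.rev l) t - (-(P.adm l.1.1 l.1.2).im * w.sq l.1.2 t +
    (P.adm l.1.1 l.1.2).im * w.re l.1.1 l.1.2 t - (P.adm l.1.1 l.1.2).re * w.im l.1.2 l.1.1 t)

/-- Loss variable minus the sum of all real flows. -/
def lossGap (t : Fin (n + 1)) : ℝ := eLoss S t ⬝ᵥ w.x - ∑ k, ∑ a ∈ P.out k, w.pf a t

/-- Net real injection at the bus `k`. -/
def netP (k : N) (t : Fin (n + 1)) : ℝ :=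
  ∑ g ∈ P.gensAt k, eP S g t ⬝ᵥ w.x - ∑ a ∈ P.out k, w.pf a t

/-- Net reactive injection at the bus `k`. -/
def netQ (k : N) (t : Fin (n + 1)) : ℝ :=
  ∑ g ∈ P.gensAt k, eQ S g t ⬝ᵥ w.x - ∑ a ∈ P.out k, w.qf a t

/-- The lifted square `Tr(a aᵀ X)`. -/
def quad (a : Idx G n S → ℝ) : ℝ := (Matrix.vecMulVec a a * w.X).trace

/-- The objective of the relaxation. -/
def cost : ℝ := P.costOf S w.x

end Lift

/-- The constraints of the semidefinite relaxation; `U` bounds the continuous variables. -/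
structure SDPFeasible (w : P.Lift S) : Prop where
  thermal : ∀ (a : P.Arc) t, w.pf a t ^ 2 + w.qf a t ^ 2 ≤ P.Smax a.1.1 a.1.2 ^ 2
  pFwd : ∀ l t, w.pFwd l t = 0
  qFwd : ∀ l t, w.qFwd l t = 0
  pRev : ∀ l t, w.pRev l t = 0
  qRev : ∀ l t, w.qRev l t = 0
  volt_min : ∀ k t, P.Vmin k ^ 2 ≤ w.sq k t
  volt_max : ∀ k t, w.sq k t ≤ P.Vmax k ^ 2
  W_psd : ∀ t, (w.W t).PosSemidef
  loss : ∀ t, w.lossGap t = 0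
  balance_re : ∀ k t, w.netP k t = (P.demand k t).re
  balance_im : ∀ k t, w.netQ k t = (P.demand k t).im
  row : ∀ r, P.rowVec S r ⬝ᵥ w.x = rowRhs r
  agg_sq : ∀ t, w.quad (aggVec S t) = P.aggRhs t ^ 2
  row_sq : ∀ r, w.quad (P.rowVec S r) = rowRhs r ^ 2
  bin : ∀ i : Bin G n, w.x (.inl i) = w.X (.inl i) (.inl i)
  bound : ∀ i : Cont G n S, w.X (.inr i) (.inr i) ≤ U i ^ 2
  corner : w.Y none none = 1
  Y_psd : w.Y.PosSemidef
  Y_nonneg : ∀ i j, 0 ≤ w.Y i j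

/-- The variables of the dual: one multiplier for each constraint of the relaxation. -/
structure Mult where
  /-- multipliers of the relaxed flow equations -/
  pFwd : P.L → Fin (n + 1) → ℝ
  qFwd : P.L → Fin (n + 1) → ℝ
  pRev : P.L → Fin (n + 1) → ℝ
  qRev : P.L → Fin (n + 1) → ℝ
  /-- multipliers `(th0, thP, thQ)` of the thermal limits `(|Smax|, p, q) ∈ second-order cone` -/
  th0 : P.Arc → Fin (n + 1) → ℝ
  thP : P.Arc → Fin (n + 1) → ℝ
  thQ : P.Arc → Fin (n + 1) → ℝ
  /-- multipliers of the voltage bounds -/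
  vmin : N → Fin (n + 1) → ℝ
  vmax : N → Fin (n + 1) → ℝ
  /-- multipliers of `W t ⪰ 0` -/
  Psi : Fin (n + 1) → Matrix (N ⊕ N) (N ⊕ N) ℝ
  /-- multipliers of the loss equations -/
  loss : Fin (n + 1) → ℝ
  /-- multipliers of the real and reactive balance equations -/
  lamR : N → Fin (n + 1) → ℝ
  lamI : N → Fin (n + 1) → ℝ
  /-- multipliers of the linear equations and of their squares -/
  gamma : Row G n → ℝ
  omega : Row G n → ℝ
  /-- multipliers of the squared aggregated demand equations -/
  lamHat : Fin (n + 1) → ℝ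
  /-- multipliers of `x_i = X_ii` for the binary variables -/
  kappa : Bin G n → ℝ
  /-- multipliers of `X_ii ≤ U_i ^ 2` for the continuous variables -/
  phi : Cont G n S → ℝ
  /-- multiplier of `Y_00 = 1` -/
  mu : ℝ
  /-- multiplier of `Y ⪰ 0` -/
  Omega : Matrix (Option (Idx G n S)) (Option (Idx G n S)) ℝ
  /-- multiplier of `Y ≥ 0` -/
  Theta : Matrix (Option (Idx G n S)) (Option (Idx G n S)) ℝ

namespace Mult

variable {P S} (m : P.Mult S)

/-- The pairing of the multipliers with the linear parts of all the constraints. -/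
def pairing (w : P.Lift S) : ℝ :=
  ∑ l, ∑ t, (m.pFwd l t * w.pFwd l t + m.qFwd l t * w.qFwd l t +
      m.pRev l t * w.pRev l t + m.qRev l t * w.qRev l t) +
    ∑ a, ∑ t, (m.thP a t * w.pf a t + m.thQ a t * w.qf a t) +
    ∑ k, ∑ t, (m.vmin k t * w.sq k t + m.vmax k t * w.sq k t) +
    ∑ t, (m.Psi t * w.W t).trace +
    ∑ t, m.loss t * w.lossGap t +
    ∑ k, ∑ t, (m.lamR k t * w.netP k t + m.lamI k t * w.netQ k t) +
    ∑ r, (m.gamma r * (P.rowVec S r ⬝ᵥ w.x) + m.omega r * w.quad (P.rowVec S r)) +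
    ∑ t, m.lamHat t * w.quad (aggVec S t) +
    ∑ i, m.kappa i * (w.x (.inl i) - w.X (.inl i) (.inl i)) +
    ∑ i, m.phi i * w.X (.inr i) (.inr i) +
    m.mu * w.Y none none +
    (m.Omega * w.Y).trace +
    (m.Theta * w.Y).trace

/-- The objective of the dual. -/
def value : ℝ :=
  -∑ a : P.Arc, ∑ t, m.th0 a t * |P.Smax a.1.1 a.1.2| +
    ∑ k, ∑ t, (m.vmin k t * P.Vmin k ^ 2 + m.vmax k t * P.Vmax k ^ 2) +
    ∑ k, ∑ t, (m.lamR k t * (P.demand k t).re + m.lamI k t * (P.demand k t).im) +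
    ∑ r, (m.gamma r * rowRhs r + m.omega r * rowRhs r ^ 2) +
    ∑ t, m.lamHat t * P.aggRhs t ^ 2 +
    ∑ i, m.phi i * U i ^ 2 +
    m.mu

end Mult

/-- The constraints of the dual. The last one is the equality of the two sides as linear functionals
of the primal variables (the matrices `W t` and `Y` being symmetric). -/
structure DualFeasible (m : P.Mult S) : Prop where
  thermal : ∀ a t, √(m.thP a t ^ 2 + m.thQ a t ^ 2) ≤ m.th0 a t
  vmin : ∀ k t, 0 ≤ m.vmin k t
  vmax : ∀ k t, m.vmax k t ≤ 0
  Psi_psd : ∀ t, (m.Psi t).PosSemidef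
  phi : ∀ i, m.phi i ≤ 0
  Omega_psd : m.Omega.PosSemidef
  Theta_symm : m.Theta.IsSymm
  Theta_nonneg : ∀ i j, 0 ≤ m.Theta i j
  stationary : ∀ w : P.Lift S, (∀ t, (w.W t).IsSymm) → w.Y.IsSymm → w.cost = m.pairing w

/-- The set of objective values of the semidefinite relaxation. -/
def primalValues : Set ℝ := { c | ∃ w : P.Lift S, P.SDPFeasible S U w ∧ w.cost = c }

/-- The set of objective values of the dual. -/
def dualValues : Set ℝ := { d | ∃ m : P.Mult S, P.DualFeasible S m ∧ m.value U = d }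

/-- Strong duality: both problems are feasible, the minimum of the relaxation is attained, and it
equals the supremum of the dual (the supremum of the empty set is not a real number). -/
def StrongDuality : Prop :=
  ∃ V : ℝ, IsLeast (P.primalValues S U) V ∧ IsLUB (P.dualValues S U) V

end Relaxation

end ACUC

end

/-! Every AC solution gives a feasible point of the relaxation by rank-one lifting
(`ACUC.Feasible.lift`). Duality needs no interior point, because the homogenized constraints have
only the zero solution (`ACUC.eq_zero_of_conMap_mem`): the thermal limits kill the flows, the upper
voltage bounds kill the trace of each `W t`, and once the corner of `Y` vanishes, semidefiniteness
kills `x`, after which `x_i = X_ii` and `X_ii ≤ 0` kill the trace of `Y`.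

Consider a finite-dimensional conic program: minimize `c w` subject to `A w - b ∈ K`, with `K` a
closed convex cone. If `A w ∈ K` forces `w = 0`, compactness of the unit sphere gives `‖w‖ ≤ C * ‖A
w - k‖` for all `k ∈ K` (`IsClosedCone.exists_norm_le`). With `k = A w - b` this bounds the feasible
set, so the minimum `V` is attained. With a varying right-hand side `y` it shows that the cone of
pairs `(y, s)` such that some `w` has `A w - y ∈ K` and `c w ≤ s` is closed. For `d < V` the point
`(b, d)` lies outside it, and a separating functional, normalized, is dual feasible with value above
`d` (`IsClosedCone.exists_isLeast_and_dual`).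

Written in coordinates, with its matrix parts symmetrized, such a functional is a multiplier of the
stated dual (`ACUC.exists_dualFeasible`). The opposite inequality is weak duality
(`ACUC.DualFeasible.value_le_cost`). -/

/-! ### Closed convex cones -/

/-- A set that is a closed convex cone with apex at the origin. -/
structure IsClosedCone {F : Type*} [AddCommGroup F] [Module ℝ F] [TopologicalSpace F]
    (K : Set F) : Prop where
  closed : IsClosed K
  zero_mem : 0 ∈ K
  add_mem : ∀ ⦃a⦄, a ∈ K → ∀ ⦃b⦄, b ∈ K → a + b ∈ K
  smul_mem : ∀ ⦃c : ℝ⦄, 0 ≤ c → ∀ ⦃a⦄, a ∈ K → c • a ∈ K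

namespace IsClosedCone

theorem prod {F F' : Type*} [AddCommGroup F] [Module ℝ F] [TopologicalSpace F]
    [AddCommGroup F'] [Module ℝ F'] [TopologicalSpace F'] {K : Set F} {K' : Set F'}
    (h : IsClosedCone K) (h' : IsClosedCone K') : IsClosedCone (K ×ˢ K') where
  closed := h.closed.prod h'.closed
  zero_mem := ⟨h.zero_mem, h'.zero_mem⟩
  add_mem _ ha _ hb := ⟨h.add_mem ha.1 hb.1, h'.add_mem ha.2 hb.2⟩
  smul_mem _ hc _ ha := ⟨h.smul_mem hc ha.1, h'.smul_mem hc ha.2⟩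

theorem singleton_zero {F : Type*} [AddCommGroup F] [Module ℝ F] [TopologicalSpace F] [T1Space F] :
    IsClosedCone ({0} : Set F) where
  closed := isClosed_singleton
  zero_mem := rfl
  add_mem a ha b hb := by simp_all
  smul_mem c _ a ha := by simp_all

/-- An intersection of preimages of closed cones under continuous linear maps. The maps allow the
three coordinates of a second-order cone to come from three separate arrays. -/
theorem forall_mem {ι : Type*} {F : ι → Type*} {H : Type*} [∀ i, AddCommGroup (F i)]
    [∀ i, Module ℝ (F i)] [∀ i, TopologicalSpace (F i)] [AddCommGroup H] [Module ℝ H]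
    [TopologicalSpace H] {K : ∀ i, Set (F i)} (h : ∀ i, IsClosedCone (K i))
    (f : ∀ i, H →L[ℝ] F i) : IsClosedCone {a | ∀ i, f i a ∈ K i} where
  closed := by
    simp only [Set.ofPred_forall]
    exact isClosed_iInter fun i => (h i).closed.preimage (f i).continuous
  zero_mem i := by simpa using (h i).zero_mem
  add_mem a ha b hb i := by simpa using (h i).add_mem (ha i) (hb i)
  smul_mem c hc a ha i := by simpa using (h i).smul_mem hc (ha i)

theorem pi {ι : Type*} {F : Type*} [AddCommGroup F] [Module ℝ F] [TopologicalSpace F] {K : Set F}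
    (h : IsClosedCone K) : IsClosedCone {a : ι → F | ∀ i, a i ∈ K} :=
  forall_mem (fun _ => h) fun i => ContinuousLinearMap.proj i

theorem nonneg : IsClosedCone {a : ℝ | 0 ≤ a} where
  closed := isClosed_Ici
  zero_mem := le_refl (0 : ℝ)
  add_mem _ ha _ hb := add_nonneg (α := ℝ) ha hb
  smul_mem _ hc _ ha := mul_nonneg hc ha

theorem nonpos : IsClosedCone {a : ℝ | a ≤ 0} where
  closed := isClosed_Iic
  zero_mem := le_refl (0 : ℝ)
  add_mem _ ha _ hb := add_nonpos (α := ℝ) ha hb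
  smul_mem _ hc _ ha := mul_nonpos_of_nonneg_of_nonpos hc ha

/-- The second-order cone in dimension three. -/
theorem secondOrder : IsClosedCone {a : ℝ × ℝ × ℝ | ‖(⟨a.2.1, a.2.2⟩ : ℂ)‖ ≤ a.1} where
  closed := by
    have : Continuous fun a : ℝ × ℝ × ℝ => (⟨a.2.1, a.2.2⟩ : ℂ) :=
      Complex.equivRealProdCLM.symm.continuous.comp continuous_snd
    exact isClosed_le this.norm continuous_fst
  zero_mem := by
    have : (⟨0, 0⟩ : ℂ) = 0 := rfl
    simp [this]
  add_mem a ha b hb := by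
    have : (⟨(a + b).2.1, (a + b).2.2⟩ : ℂ) = ⟨a.2.1, a.2.2⟩ + ⟨b.2.1, b.2.2⟩ := rfl
    simp only [Set.mem_ofPred_eq] at *
    rw [this]
    exact (norm_add_le _ _).trans (add_le_add ha hb)
  smul_mem c hc a ha := by
    have : (⟨(c • a).2.1, (c • a).2.2⟩ : ℂ) = c • (⟨a.2.1, a.2.2⟩ : ℂ) := by
      apply Complex.ext <;> simp
    simp only [Set.mem_ofPred_eq] at *
    rw [this, norm_smul, Real.norm_of_nonneg hc]
    exact mul_le_mul_of_nonneg_left ha hc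

/-- Symmetry is a closed condition, and for each fixed vector the quadratic form is continuous in
the matrix entries. -/
theorem posSemidef {m : Type*} [Fintype m] :
    IsClosedCone {a : m → m → ℝ | (Matrix.of a).PosSemidef} where
  closed := by
    simp only [Matrix.posSemidef_iff_dotProduct_mulVec, Set.ofPred_and, Set.ofPred_forall]
    refine IsClosed.inter ?_ (isClosed_iInter fun x => ?_)
    · simp only [Matrix.IsHermitian]
      refine isClosed_eq ?_ ?_
      · exact Continuous.matrix_conjTranspose (A := fun a : m → m → ℝ => Matrix.of a) continuous_id
      · exact continuous_id
    · refine isClosed_le continuous_const ?_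
      simp only [dotProduct, Matrix.mulVec, Matrix.of_apply]
      fun_prop
  zero_mem := Matrix.PosSemidef.zero
  add_mem _ ha _ hb := Matrix.PosSemidef.add ha hb
  smul_mem _ hc _ ha := Matrix.PosSemidef.smul ha hc

end IsClosedCone

/-! ### Conic duality without recession directions -/

section ConicDuality

variable {E F : Type*} [NormedAddCommGroup E] [NormedSpace ℝ E] [FiniteDimensional ℝ E]
  [NormedAddCommGroup F] [NormedSpace ℝ F]

/-- If a linear map sends no nonzero vector into a closed cone, then it sends unit vectors to a
positive distance from it. -/
theorem IsClosedCone.exists_norm_le {K : Set F} (hK : IsClosedCone K) (A : E →L[ℝ] F)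
    (hA : ∀ w, A w ∈ K → w = 0) :
    ∃ C : ℝ, ∀ w, ∀ k ∈ K, ‖w‖ ≤ C * ‖A w - k‖ := by
  have hcont : ContinuousOn (fun w => Metric.infDist (A w) K) (Metric.sphere 0 1) :=
    ((Metric.continuous_infDist_pt K).comp A.continuous).continuousOn
  have hpos : ∀ w ∈ Metric.sphere (0 : E) 1, 0 < Metric.infDist (A w) K := fun w hw => by
    rw [← hK.closed.notMem_iff_infDist_pos ⟨0, hK.zero_mem⟩]
    intro h
    simp [hA w h] at hw
  obtain ⟨δ, hδ, hle⟩ : ∃ δ > 0, ∀ w ∈ Metric.sphere (0 : E) 1, δ ≤ Metric.infDist (A w) K := by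
    rcases (Metric.sphere (0 : E) 1).eq_empty_or_nonempty with h | h
    -- The sphere is empty when `E` is trivial; any positive constant then serves.
    · exact ⟨1, one_pos, by simp [h]⟩
    · obtain ⟨w, hw, hmin⟩ := (isCompact_sphere (0 : E) 1).exists_isMinOn h hcont
      exact ⟨_, hpos w hw, fun v hv => hmin hv⟩
  refine ⟨δ⁻¹, fun w k hk => ?_⟩
  rcases eq_or_ne w 0 with rfl | hw
  · simp only [norm_zero]; positivity
  have hn : 0 < ‖w‖ := norm_pos_iff.2 hw
  -- Rescale `w` to a unit vector; the rescaled `k` stays in the cone.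
  have h1 : δ ≤ ‖A (‖w‖⁻¹ • w) - ‖w‖⁻¹ • k‖ := by
    refine (hle (‖w‖⁻¹ • w) ?_).trans ?_
    · simp [norm_smul, hn.ne']
    · rw [← dist_eq_norm]
      exact Metric.infDist_le_dist_of_mem (hK.smul_mem (by positivity) hk)
  rw [map_smul, ← smul_sub, norm_smul, norm_inv, norm_norm, inv_mul_eq_div, le_div_iff₀ hn] at h1
  rw [inv_mul_eq_div, le_div_iff₀ hδ]
  linarith

/-- The epigraph cone of a conic program without nonzero recession directions is closed. -/
theorem IsClosedCone.isClosed_epigraph {K : Set F} (hK : IsClosedCone K) (A : E →L[ℝ] F)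
    (c : E →L[ℝ] ℝ) (hA : ∀ w, A w ∈ K → w = 0) :
    IsClosed {y : F × ℝ | ∃ w, A w - y.1 ∈ K ∧ c w ≤ y.2} := by
  obtain ⟨C, hC⟩ := hK.exists_norm_le A hA
  refine IsSeqClosed.isClosed fun y y₀ hy hlim => ?_
  choose w hw hcw using hy
  -- The norm estimate with `k = A w - y.1` bounds the witnesses by the convergent right-hand sides,
  -- so a subsequence of them converges.
  have hb : Bornology.IsBounded (Set.range w) := by
    obtain ⟨M, hM⟩ := (Metric.isBounded_range_of_tendsto _ hlim).exists_norm_le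
    refine isBounded_iff_forall_norm_le.2 ⟨|C| * M, ?_⟩
    rintro _ ⟨i, rfl⟩
    have h1 := hC (w i) _ (hw i)
    rw [sub_sub_cancel] at h1
    calc ‖w i‖ ≤ C * ‖(y i).1‖ := h1
      _ ≤ |C| * ‖(y i).1‖ := by gcongr; exact le_abs_self C
      _ ≤ |C| * M := by
        gcongr
        exact (norm_fst_le (y i)).trans (hM _ ⟨i, rfl⟩)
  obtain ⟨w₀, -, φ, hφ, hφlim⟩ := tendsto_subseq_of_bounded hb fun i => ⟨i, rfl⟩
  have hy' := hlim.comp hφ.tendsto_atTop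
  refine ⟨w₀, ?_, ?_⟩
  · refine hK.closed.mem_of_tendsto (((A.continuous.tendsto _).comp hφlim).sub
      ((continuous_fst.tendsto _).comp hy')) (.of_forall fun i => hw (φ i))
  · exact le_of_tendsto_of_tendsto' ((c.continuous.tendsto _).comp hφlim)
      ((continuous_snd.tendsto _).comp hy') fun i => hcw (φ i)

/-- A feasible conic program without nonzero recession directions attains its minimum, and the
minimum is approached by the values of dual feasible functionals. -/
theorem IsClosedCone.exists_isLeast_and_dual_of_normed {K : Set F} (hK : IsClosedCone K) (A : E →ₗ[ℝ] F)
    (c : E →ₗ[ℝ] ℝ) (b : F) (hA : ∀ w, A w ∈ K → w = 0) (hfeas : ∃ w, A w - b ∈ K) :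
    ∃ V, IsLeast (c '' {w | A w - b ∈ K}) V ∧
      ∀ d < V, ∃ f : F →ₗ[ℝ] ℝ, (∀ k ∈ K, 0 ≤ f k) ∧ (∀ w, c w = f (A w)) ∧ d < f b := by
  obtain ⟨A, rfl⟩ : ∃ A' : E →L[ℝ] F, A'.toLinearMap = A := ⟨A.toContinuousLinearMap, rfl⟩
  obtain ⟨c, rfl⟩ : ∃ c' : E →L[ℝ] ℝ, c'.toLinearMap = c := ⟨c.toContinuousLinearMap, rfl⟩
  simp only [ContinuousLinearMap.coe_coe] at hA hfeas ⊢
  obtain ⟨C, hC⟩ := hK.exists_norm_le A hA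
  have hcomp : IsCompact {w | A w - b ∈ K} := by
    refine Metric.isCompact_of_isClosed_isBounded
      (hK.closed.preimage (A.continuous.sub continuous_const)) ?_
    refine isBounded_iff_forall_norm_le.2 ⟨C * ‖b‖, fun w hw => ?_⟩
    simpa using hC w _ hw
  obtain ⟨w₁, hw₁, hmin⟩ := hcomp.exists_isMinOn hfeas c.continuous.continuousOn
  have hlow : ∀ w, A w - b ∈ K → c w₁ ≤ c w := fun w hw => hmin hw
  refine ⟨c w₁, ⟨⟨w₁, hw₁, rfl⟩, ?_⟩, fun d hd => ?_⟩
  · rintro _ ⟨w, hw, rfl⟩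
    exact hlow w hw
  let C' : ProperCone ℝ (F × ℝ) :=
    { carrier := {y : F × ℝ | ∃ w, A w - y.1 ∈ K ∧ c w ≤ y.2}
      add_mem' := by
        rintro y y' ⟨w, h1, h2⟩ ⟨w', h1', h2'⟩
        refine ⟨w + w', ?_, ?_⟩
        · have := hK.add_mem h1 h1'
          rwa [sub_add_sub_comm, ← map_add] at this
        · simpa using add_le_add h2 h2'
      zero_mem' := ⟨0, by simpa using hK.zero_mem, by simp⟩
      smul_mem' := by
        rintro r y ⟨w, h1, h2⟩
        refine ⟨(r : ℝ) • w, ?_, ?_⟩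
        · have := hK.smul_mem r.2 h1
          rwa [smul_sub, ← map_smul] at this
        · rw [map_smul]
          exact mul_le_mul_of_nonneg_left h2 r.2
      isClosed' := hK.isClosed_epigraph A c hA }
  have hmem : ∀ y : F × ℝ, y ∈ C' ↔ ∃ w, A w - y.1 ∈ K ∧ c w ≤ y.2 := fun y => Iff.rfl
  obtain ⟨f, hf, hneg⟩ := C'.hyperplane_separation_point (x₀ := (b, d)) (by
    rw [hmem]
    rintro ⟨w, h1, h2⟩
    exact (hd.trans_le (hlow w h1)).not_ge h2)
  set g : F →L[ℝ] ℝ := f.comp (ContinuousLinearMap.inl ℝ F ℝ) with hg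
  set τ : ℝ := f (0, 1) with hτ
  have hfg : ∀ y s, f (y, s) = g y + s * τ := fun y s => by
    have : (y, s) = ContinuousLinearMap.inl ℝ F ℝ y + s • ((0, 1) : F × ℝ) := by simp
    rw [this, map_add, map_smul]; rfl
  -- The pairs `(A w - k, c w + r)` lie in the separated cone. Its choices `w = 0` and `±w` yield
  -- the sign and stationarity conditions below.
  have hcone : ∀ w, ∀ k ∈ K, ∀ r : ℝ, 0 ≤ r → 0 ≤ g (A w - k) + (c w + r) * τ := by
    intro w k hk r hr
    rw [← hfg]
    exact hf _ ((hmem _).2 ⟨w, by simpa using hk, by simpa using hr⟩)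
  have hτ0 : 0 ≤ τ := by simpa using hcone 0 0 hK.zero_mem 1 zero_le_one
  have hgK : ∀ k ∈ K, 0 ≤ -g k := fun k hk => by simpa using hcone 0 k hk 0 le_rfl
  have hstat : ∀ w, g (A w) + c w * τ = 0 := by
    intro w
    have h1 := hcone w 0 hK.zero_mem 0 le_rfl
    have h2 := hcone (-w) 0 hK.zero_mem 0 le_rfl
    simp only [map_neg, sub_zero, add_zero] at h1 h2
    linarith
  rw [hfg] at hneg
  -- The separating hyperplane is not vertical: if `τ = 0`, then `g` vanishes on the range of `A`,
  -- so the feasible point `w₁` gives `0 ≤ g b`, whereas separation says `g b < 0`.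
  have hτpos : 0 < τ := by
    refine hτ0.lt_of_ne fun h => ?_
    have h1 := hgK _ hw₁
    have h2 := hstat w₁
    rw [map_sub] at h1
    rw [← h] at h2 hneg
    linarith
  -- Dividing by `τ` gives the cost coefficient one; the sign turns `g ≤ 0` on `K` into dual
  -- nonnegativity.
  refine ⟨(-(τ⁻¹ • g) : F →L[ℝ] ℝ).toLinearMap, fun k hk => ?_, fun w => ?_, ?_⟩
  · have := mul_nonneg (inv_nonneg.2 hτ0) (hgK k hk)
    simpa using this
  · have := hstat w
    simp only [ContinuousLinearMap.coe_coe, neg_apply, smul_apply, smul_eq_mul]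
    field_simp
    linarith
  · simp only [ContinuousLinearMap.coe_coe, neg_apply, smul_apply, smul_eq_mul]
    rw [← mul_neg, inv_mul_eq_div, lt_div_iff₀ hτpos]
    linarith

/-- A feasible conic program without nonzero recession directions attains its minimum, and the
minimum is approached by the values of dual feasible functionals. -/
theorem IsClosedCone.exists_isLeast_and_dual {E F : Type*} [AddCommGroup E] [Module ℝ E]
    [TopologicalSpace E] [IsTopologicalAddGroup E] [ContinuousSMul ℝ E] [T2Space E]
    [FiniteDimensional ℝ E] [AddCommGroup F] [Module ℝ F] [TopologicalSpace F]
    [IsTopologicalAddGroup F] [ContinuousSMul ℝ F] [T2Space F] [FiniteDimensional ℝ F]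
    {K : Set F} (hK : IsClosedCone K) (A : E →ₗ[ℝ] F) (c : E →ₗ[ℝ] ℝ) (b : F)
    (hA : ∀ w, A w ∈ K → w = 0) (hfeas : ∃ w, A w - b ∈ K) :
    ∃ V, IsLeast (c '' {w | A w - b ∈ K}) V ∧
      ∀ d < V, ∃ f : F →ₗ[ℝ] ℝ, (∀ k ∈ K, 0 ≤ f k) ∧ (∀ w, c w = f (A w)) ∧ d < f b := by
  -- The claim depends only on the linear and topological structure, so both spaces may be replaced
  -- by Euclidean ones.
  set φ := toEuclidean (E := E)
  set ψ := toEuclidean (E := F)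
  have hK' : IsClosedCone (ψ.symm ⁻¹' K) :=
    { closed := hK.closed.preimage ψ.symm.continuous
      zero_mem := by simpa using hK.zero_mem
      add_mem := fun a ha b hb => by simpa using hK.add_mem ha hb
      smul_mem := fun r hr a ha => by simpa using hK.smul_mem hr ha }
  set A' := ψ.toLinearEquiv.toLinearMap ∘ₗ A ∘ₗ φ.symm.toLinearEquiv.toLinearMap
  set c' := c ∘ₗ φ.symm.toLinearEquiv.toLinearMap
  have hA' : ∀ w, A' w = ψ (A (φ.symm w)) := fun w => rfl
  have hc' : ∀ w, c' w = c (φ.symm w) := fun w => rfl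
  have hmem : ∀ w, A' w - ψ b ∈ ψ.symm ⁻¹' K ↔ A (φ.symm w) - b ∈ K := fun w => by
    rw [hA', ← map_sub, Set.mem_preimage, ψ.symm_apply_apply]
  obtain ⟨V, hV, hdual⟩ := hK'.exists_isLeast_and_dual_of_normed A' c' (ψ b)
    (fun w hw => by
      rw [hA', Set.mem_preimage, ψ.symm_apply_apply] at hw
      simpa using hA _ hw)
    (hfeas.imp' φ fun w hw => by rwa [hmem, φ.symm_apply_apply])
  refine ⟨V, ?_, fun d hd => ?_⟩
  · convert hV using 1
    ext r
    constructor
    · rintro ⟨w, hw, rfl⟩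
      exact ⟨φ w, by rwa [Set.mem_ofPred_eq, hmem, φ.symm_apply_apply], by
        rw [hc', φ.symm_apply_apply]⟩
    · rintro ⟨w, hw, rfl⟩
      exact ⟨φ.symm w, (hmem w).1 hw, rfl⟩
  · obtain ⟨f, hfK, hst, hfb⟩ := hdual d hd
    refine ⟨f ∘ₗ ψ.toLinearEquiv.toLinearMap, fun k hk => hfK (ψ k) ?_, fun w => ?_, hfb⟩
    · rwa [Set.mem_preimage, ψ.symm_apply_apply]
    · have := hst (φ w)
      rwa [hc', hA', φ.symm_apply_apply] at this

end ConicDuality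

/-! ### Coordinates of linear functionals -/

section Representation

/-- A linear functional on a product splits. -/
theorem LinearMap.exists_eq_add_of_prod {M M' : Type*} [AddCommGroup M] [Module ℝ M]
    [AddCommGroup M'] [Module ℝ M'] (f : M × M' →ₗ[ℝ] ℝ) :
    ∃ (g : M →ₗ[ℝ] ℝ) (h : M' →ₗ[ℝ] ℝ), ∀ a b, f (a, b) = g a + h b :=
  ⟨f.comp (.inl ℝ M M'), f.comp (.inr ℝ M M'), fun a b => by simp [← map_add]⟩

/-- A linear functional on a finite power of `ℝ` is given by coefficients. -/
theorem LinearMap.exists_coeff {ι : Type*} [Fintype ι] (f : (ι → ℝ) →ₗ[ℝ] ℝ) :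
    ∃ m : ι → ℝ, ∀ a, f a = ∑ i, m i * a i := by
  classical
  exact ⟨_, fun a => (f.pi_apply_eq_sum_univ a).trans
    (Finset.sum_congr rfl fun i _ => mul_comm _ _)⟩

theorem LinearMap.exists_coeff₂ {ι κ : Type*} [Fintype ι] [Fintype κ]
    (f : (ι → κ → ℝ) →ₗ[ℝ] ℝ) :
    ∃ m : ι → κ → ℝ, ∀ a, f a = ∑ i, ∑ j, m i j * a i j := by
  obtain ⟨m, hm⟩ := (f.comp (LinearEquiv.curry ℝ ℝ ι κ).toLinearMap).exists_coeff
  refine ⟨fun i j => m (i, j), fun a => ?_⟩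
  have := hm (fun p => a p.1 p.2)
  rw [Fintype.sum_prod_type] at this
  exact this

theorem LinearMap.exists_coeff₃ {ι κ μ : Type*} [Fintype ι] [Fintype κ] [Fintype μ]
    (f : (ι → κ → μ → ℝ) →ₗ[ℝ] ℝ) :
    ∃ m : ι → κ → μ → ℝ, ∀ a, f a = ∑ i, ∑ j, ∑ k, m i j k * a i j k := by
  obtain ⟨m, hm⟩ := (f.comp (LinearEquiv.curry ℝ (μ → ℝ) ι κ).toLinearMap).exists_coeff₂
  refine ⟨fun i j => m (i, j), fun a => ?_⟩
  have := hm (fun p => a p.1 p.2)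
  rw [Fintype.sum_prod_type] at this
  exact this

end Representation

/-! ### Symmetric parts and trace pairings -/

namespace Matrix

variable {m : Type*}

/-- The symmetric part of a bilinear form. -/
noncomputable def symmPart (c : m → m → ℝ) : Matrix m m ℝ := of fun i j => (c i j + c j i) / 2

theorem symmPart_isSymm (c : m → m → ℝ) : (symmPart c).IsSymm := by
  ext i j
  simp [symmPart, add_comm]

theorem symmPart_nonneg {c : m → m → ℝ} (hc : ∀ i j, 0 ≤ c i j) (i j : m) :
    0 ≤ symmPart c i j := div_nonneg (add_nonneg (hc i j) (hc j i)) two_pos.le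

/-- Transposing the double sum exchanges `c i j` with `c j i`, so a symmetric matrix sees only the
symmetric part of the form. This lets arbitrary coefficients be replaced by symmetric multipliers.
-/
theorem trace_symmPart_mul [Fintype m] (c : m → m → ℝ) {A : Matrix m m ℝ} (hA : A.IsSymm) :
    (symmPart c * A).trace = ∑ i, ∑ j, c i j * A i j := by
  have h1 : (symmPart c * A).trace = ∑ i, ∑ j, (c i j + c j i) / 2 * A i j := by
    simp only [trace, diag, mul_apply, symmPart, of_apply]
    refine Finset.sum_congr rfl fun i _ => Finset.sum_congr rfl fun j _ => ?_
    rw [hA.apply]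
  have h2 : ∑ i, ∑ j, c j i * A i j = ∑ i, ∑ j, c i j * A i j := by
    rw [Finset.sum_comm]
    refine Finset.sum_congr rfl fun i _ => Finset.sum_congr rfl fun j _ => ?_
    rw [hA.apply]
  have h3 : ∑ i, ∑ j, (c i j + c j i) / 2 * A i j =
      (∑ i, ∑ j, c i j * A i j + ∑ i, ∑ j, c j i * A i j) / 2 := by
    rw [← Finset.sum_add_distrib, Finset.sum_div]
    refine Finset.sum_congr rfl fun i _ => ?_
    rw [← Finset.sum_add_distrib, Finset.sum_div]
    refine Finset.sum_congr rfl fun j _ => ?_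
    ring
  rw [h1, h3, h2]
  ring

/-- A bilinear form that is nonnegative on positive semidefinite matrices has a positive
semidefinite symmetric part. -/
theorem symmPart_posSemidef [Fintype m] {c : m → m → ℝ}
    (hc : ∀ A : Matrix m m ℝ, A.PosSemidef → 0 ≤ ∑ i, ∑ j, c i j * A i j) :
    (symmPart c).PosSemidef := by
  refine .of_dotProduct_mulVec_nonneg ?_ fun v => ?_
  · rw [IsHermitian, conjTranspose_eq_transpose_of_trivial]
    exact symmPart_isSymm c
  -- Testing on the rank-one matrix `v vᵀ` gives the quadratic form at `v`.
  · have hv : (vecMulVec v v).PosSemidef := by simpa using posSemidef_vecMulVec_self_star v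
    have hs : (vecMulVec v v).IsSymm := by
      ext i j
      simp [vecMulVec_apply, mul_comm]
    have := hc _ hv
    rw [← trace_symmPart_mul c hs] at this
    refine this.trans_eq ?_
    simp only [trace, diag, mul_apply, dotProduct, mulVec, vecMulVec_apply, Pi.star_apply,
      star_trivial, Finset.mul_sum]
    refine Finset.sum_congr rfl fun i _ => Finset.sum_congr rfl fun j _ => ?_
    ring

/-- Splitting `B` into rank-one terms `v vᵀ` turns the trace into a sum of values of the quadratic
form of `A`. -/
theorem PosSemidef.trace_mul_nonneg [Fintype m] {A B : Matrix m m ℝ} (hA : A.PosSemidef)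
    (hB : B.PosSemidef) : 0 ≤ (A * B).trace := by
  obtain ⟨r, v, rfl⟩ := posSemidef_iff_eq_sum_vecMulVec.mp hB
  rw [Finset.mul_sum, trace_sum]
  refine Finset.sum_nonneg fun i _ => ?_
  rw [mul_vecMulVec, trace_vecMulVec, dotProduct_comm]
  exact hA.dotProduct_mulVec_nonneg (v i)

theorem trace_mul_nonneg_of_nonneg [Fintype m] {A B : Matrix m m ℝ} (hA : ∀ i j, 0 ≤ A i j)
    (hB : ∀ i j, 0 ≤ B i j) : 0 ≤ (A * B).trace :=
  Finset.sum_nonneg fun i _ => Finset.sum_nonneg fun j _ => mul_nonneg (hA i j) (hB j i)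

theorem PosSemidef.isSymm {A : Matrix m m ℝ} (hA : A.PosSemidef) : A.IsSymm := by
  rw [IsSymm, ← conjTranspose_eq_transpose_of_trivial]
  exact hA.isHermitian

end Matrix

/-! ### Rank-one lifting of AC solutions -/

namespace ACUC

section Lifting

variable {N G : Type*} [Fintype N] [DecidableEq N] [Fintype G] [DecidableEq G] {n : ℕ}
  {P : ACUC N G n} (S : Finset (Quantity G n))

/-- The vector of all variables of the unit commitment constraints at a solution of ACUC. -/
noncomputable def fullVec (y : P.Sol) : Idx G n S → ℝ
  | .inl i => P.preVec S y (.inl i)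
  | .inr i => P.contVal S y i

variable (y : P.Sol)

theorem fullVec_pos (f : Quantity G n) :
    fullVec S y (.inr (.pos f)) = max (P.quantity y f) 0 := rfl

theorem fullVec_neg (f : { f : Quantity G n // f ∈ S }) :
    fullVec S y (.inr (.neg f)) = max (-P.quantity y f.1) 0 := rfl

theorem eP_dotProduct_fullVec (g : G) (t : Fin (n + 1)) :
    eP S g t ⬝ᵥ fullVec S y = (y.gen g t).re := by
  simp [eP, fullVec, contVal, preVec]

theorem eU_dotProduct_fullVec (g : G) (t : Fin (n + 1)) :
    eU S g t ⬝ᵥ fullVec S y = y.u g t := by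
  simp [eU, fullVec, preVec]

theorem eV_dotProduct_fullVec (g : G) (t : Fin (n + 1)) :
    eV S g t ⬝ᵥ fullVec S y = y.v g t := by
  simp [eV, fullVec, preVec]

theorem eZ_dotProduct_fullVec (g : G) (t : Fin (n + 1)) :
    eZ S g t ⬝ᵥ fullVec S y = y.z g t := by
  simp [eZ, fullVec, preVec]

/-- A signed quantity is the difference of its positive and negative parts; an unsigned one equals
its positive part by `NonnegOutside`. -/
theorem eF_dotProduct_fullVec (hS : P.NonnegOutside S) (hy : P.Feasible y) (f : Quantity G n) :
    eF S f ⬝ᵥ fullVec S y = P.quantity y f := by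
  by_cases h : f ∈ S
  · simp only [eF, h, dite_true, sub_dotProduct, single_dotProduct, one_mul, fullVec_pos,
      fullVec_neg]
    simp
  · simp only [eF, h, dite_false, sub_zero, single_dotProduct, one_mul, fullVec_pos]
    exact max_eq_left (hS y hy f h)

omit [Fintype N] [DecidableEq N] [Fintype G] in
theorem ineqVec_slack (r r' : Ineq G n) : P.ineqVec S r (.inr (.slack r')) = 0 := by
  have hF : ∀ f, eF S f (.inr (.slack r')) = 0 := fun f => by
    unfold eF
    split_ifs <;> simp
  cases r <;> simp [ineqVec, eU, eV, eZ, eP, eQ, hF]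

/-- Inequality coefficients vanish on slack indices, so defining the slacks from `preVec` is not
circular: filling them in leaves the left-hand sides unchanged. -/
theorem ineqVec_dotProduct_preVec (r : Ineq G n) :
    P.ineqVec S r ⬝ᵥ P.preVec S y = P.ineqVec S r ⬝ᵥ fullVec S y := by
  refine Finset.sum_congr rfl fun i _ => ?_
  rcases i with i | i
  · rfl
  · cases i with
    | slack r' => simp [ineqVec_slack]
    | _ => rfl

theorem contVal_slack (r : Ineq G n) :
    P.contVal S y (.slack r) = ineqRhs r - P.ineqVec S r ⬝ᵥ fullVec S y := by
  rw [← ineqVec_dotProduct_preVec]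
  rfl

variable {S y}

theorem Feasible.ineqVec_le (hy : P.Feasible y) (hS : P.NonnegOutside S) (r : Ineq G n) :
    P.ineqVec S r ⬝ᵥ fullVec S y ≤ ineqRhs r := by
  have hq := fun g t => eF_dotProduct_fullVec S y hS hy (.inl (g, t))
  simp only [quantity] at hq
  cases r with
  | pMin g t =>
    have := hy.p_min g t
    simp only [ineqVec, ineqRhs, sub_dotProduct, smul_dotProduct, eP_dotProduct_fullVec,
      eZ_dotProduct_fullVec, smul_eq_mul]
    linarith
  | pMax g t =>
    have := hy.p_max g t
    simp only [ineqVec, ineqRhs, sub_dotProduct, smul_dotProduct, eP_dotProduct_fullVec,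
      eZ_dotProduct_fullVec, smul_eq_mul]
    linarith
  | qMin g t =>
    have := hy.q_min g t
    simp only [ineqVec, ineqRhs, sub_dotProduct, smul_dotProduct, eQ, hq,
      eZ_dotProduct_fullVec, smul_eq_mul]
    linarith
  | qMax g t =>
    have := hy.q_max g t
    simp only [ineqVec, ineqRhs, sub_dotProduct, smul_dotProduct, eQ, hq,
      eZ_dotProduct_fullVec, smul_eq_mul]
    linarith
  | rampUp g s =>
    have := hy.ramp_up g s
    simp only [ineqVec, ineqRhs, sub_dotProduct, smul_dotProduct, eP_dotProduct_fullVec,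
      eZ_dotProduct_fullVec, eU_dotProduct_fullVec, smul_eq_mul]
    linarith
  | rampDown g s =>
    have := hy.ramp_down g s
    simp only [ineqVec, ineqRhs, sub_dotProduct, smul_dotProduct, eP_dotProduct_fullVec,
      eZ_dotProduct_fullVec, eV_dotProduct_fullVec, smul_eq_mul]
    linarith
  | minUp g s =>
    have := hy.min_up g s
    simp only [ineqVec, ineqRhs, sub_dotProduct, sum_dotProduct, eU_dotProduct_fullVec,
      eZ_dotProduct_fullVec]
    linarith
  | minDown g s =>
    have := hy.min_down g s
    simp only [ineqVec, ineqRhs, add_dotProduct, sum_dotProduct, eV_dotProduct_fullVec,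
      eZ_dotProduct_fullVec]
    linarith
  | binUb i =>
    simp only [ineqVec, ineqRhs, single_dotProduct, one_mul]
    cases i with
    | u g t => rcases hy.u_bin g t with h | h <;> simp [fullVec, preVec, h]
    | v g t => rcases hy.v_bin g t with h | h <;> simp [fullVec, preVec, h]
    | z g t => rcases hy.z_bin g t with h | h <;> simp [fullVec, preVec, h]

theorem Feasible.fullVec_bin (hy : P.Feasible y) (i : Bin G n) :
    fullVec S y (.inl i) = 0 ∨ fullVec S y (.inl i) = 1 := by
  cases i with
  | u g t => exact hy.u_bin g t
  | v g t => exact hy.v_bin g t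
  | z g t => exact hy.z_bin g t

theorem Feasible.fullVec_nonneg (hy : P.Feasible y) (hS : P.NonnegOutside S) (i : Idx G n S) :
    0 ≤ fullVec S y i := by
  rcases i with i | i
  · rcases hy.fullVec_bin (S := S) i with h | h <;> simp [h]
  · cases i with
    | p g t => exact hy.p_nonneg g t
    | pos f => exact le_max_right _ _
    | neg f => exact le_max_right _ _
    | slack r =>
      change 0 ≤ P.contVal S y (.slack r)
      rw [contVal_slack]
      exact sub_nonneg.2 (hy.ineqVec_le hS r)

theorem Feasible.rowVec_eq (hy : P.Feasible y) (r : Row G n) :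
    P.rowVec S r ⬝ᵥ fullVec S y = rowRhs r := by
  rcases r with r | ⟨g, s⟩
  · simp only [rowVec, rowRhs, add_dotProduct, single_dotProduct, one_mul]
    change _ + P.contVal S y (.slack r) = _
    rw [contVal_slack]
    ring
  · have := hy.logic g s
    simp only [rowVec, rowRhs, add_dotProduct, sub_dotProduct, eU_dotProduct_fullVec,
      eV_dotProduct_fullVec, eZ_dotProduct_fullVec]
    linarith

/-- Sum the real balance equations over all buses: the flows add up to the loss, and each generator
sits at exactly one bus. -/
theorem Feasible.aggVec_eq (hy : P.Feasible y) (hS : P.NonnegOutside S) (t : Fin (n + 1)) :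
    aggVec S t ⬝ᵥ fullVec S y = P.aggRhs t := by
  have h : ∀ k, (P.demand k t).re =
      ∑ g ∈ P.gensAt k, (y.gen g t).re - ∑ a ∈ P.out k, (y.flow a t).re := fun k => by
    rw [← hy.balance k t]
    simp
  simp only [aggVec, sub_dotProduct, sum_dotProduct, eP_dotProduct_fullVec, eLoss,
    eF_dotProduct_fullVec S y hS hy, quantity, loss, aggRhs, h, Finset.sum_sub_distrib]
  congr 1
  exact (Finset.sum_fiberwise Finset.univ P.bus fun g => (y.gen g t).re).symm

/-- Real and imaginary parts of the voltages. -/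
def voltVec (y : P.Sol) (t : Fin (n + 1)) : N ⊕ N → ℝ :=
  Sum.elim (fun k => (y.volt k t).re) fun k => (y.volt k t).im

/-- The vector `(1, x)`. -/
noncomputable def homVec (S : Finset (Quantity G n)) (y : P.Sol) : Option (Idx G n S) → ℝ
  | none => 1
  | some i => fullVec S y i

/-- The rank-one lifting of a solution of ACUC. -/
noncomputable def lift (S : Finset (Quantity G n)) (y : P.Sol) : P.Lift S where
  pf a t := (y.flow a t).re
  qf a t := (y.flow a t).im
  W t := Matrix.vecMulVec (voltVec y t) (voltVec y t)
  Y := Matrix.vecMulVec (homVec S y) (homVec S y)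

theorem lift_x : (lift S y).x = fullVec S y := by
  ext i
  simp [Lift.x, lift, Matrix.vecMulVec_apply, homVec]

theorem lift_X : (lift S y).X = Matrix.vecMulVec (fullVec S y) (fullVec S y) := by
  ext i j
  simp [Lift.X, lift, Matrix.vecMulVec_apply, homVec]

theorem lift_quad (a : Idx G n S → ℝ) : (lift S y).quad a = (a ⬝ᵥ fullVec S y) ^ 2 := by
  rw [Lift.quad, lift_X, Matrix.vecMulVec_mul_vecMulVec, Matrix.trace_vecMulVec,
    dotProduct_smul, smul_eq_mul, sq]

theorem lift_sq (k : N) (t : Fin (n + 1)) : (lift S y).sq k t = ‖y.volt k t‖ ^ 2 := by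
  rw [Complex.sq_norm, Complex.normSq_apply]
  simp [Lift.sq, lift, Matrix.vecMulVec_apply, voltVec]

/-- On rank-one matrices each lifted square is an actual square, so every lifted equation is the
square of a valid one, and `x_i = X_ii` says that binaries are idempotent. Squaring the lower
voltage limits uses `hV`; squaring `x_i ≤ U_i` uses nonnegativity of `x`. -/
theorem Feasible.lift (hy : P.Feasible y) (hV : ∀ k, 0 ≤ P.Vmin k) (hS : P.NonnegOutside S)
    {U : Cont G n S → ℝ} (hU : P.BoundedBy S U) : P.SDPFeasible S U (lift S y) where
  thermal a t := by
    have := hy.thermal a t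
    rw [Complex.sq_norm, Complex.normSq_apply] at this
    simp only [ACUC.lift]
    linarith
  pFwd l t := by
    simp [Lift.pFwd, Lift.sq, Lift.re, Lift.im, ACUC.lift, Matrix.vecMulVec_apply, voltVec,
      hy.flow_fwd l t]
    ring
  qFwd l t := by
    simp [Lift.qFwd, Lift.sq, Lift.re, Lift.im, ACUC.lift, Matrix.vecMulVec_apply, voltVec,
      hy.flow_fwd l t]
    ring
  pRev l t := by
    simp [Lift.pRev, Lift.sq, Lift.re, Lift.im, ACUC.lift, Matrix.vecMulVec_apply, voltVec,
      hy.flow_rev l t]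
    ring
  qRev l t := by
    simp [Lift.qRev, Lift.sq, Lift.re, Lift.im, ACUC.lift, Matrix.vecMulVec_apply, voltVec,
      hy.flow_rev l t]
    ring
  volt_min k t := by
    rw [lift_sq]
    exact pow_le_pow_left₀ (hV k) (hy.volt_min k t) 2
  volt_max k t := by
    rw [lift_sq]
    exact pow_le_pow_left₀ (norm_nonneg _) (hy.volt_max k t) 2
  W_psd t := by
    simpa [ACUC.lift] using Matrix.posSemidef_vecMulVec_self_star (voltVec y t)
  loss t := by
    rw [Lift.lossGap, lift_x, eLoss, eF_dotProduct_fullVec S y hS hy]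
    exact sub_self _
  balance_re k t := by
    rw [← hy.balance k t]
    simp only [Lift.netP, lift_x, eP_dotProduct_fullVec]
    simp [ACUC.lift]
  balance_im k t := by
    rw [← hy.balance k t]
    simp only [Lift.netQ, lift_x, eQ, eF_dotProduct_fullVec S y hS hy, quantity]
    simp [ACUC.lift]
  row r := by rw [lift_x, hy.rowVec_eq]
  agg_sq t := by rw [lift_quad, hy.aggVec_eq hS]
  row_sq r := by rw [lift_quad, hy.rowVec_eq]
  bin i := by
    rw [lift_x, lift_X, Matrix.vecMulVec_apply]
    rcases hy.fullVec_bin (S := S) i with h | h <;> simp [h]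
  bound i := by
    rw [lift_X, Matrix.vecMulVec_apply, ← sq]
    exact pow_le_pow_left₀ (hy.fullVec_nonneg hS _) (hU y hy i) 2
  corner := by simp [ACUC.lift, homVec, Matrix.vecMulVec_apply]
  Y_psd := by
    simpa [ACUC.lift] using Matrix.posSemidef_vecMulVec_self_star (homVec S y)
  Y_nonneg i j := by
    have h : ∀ i, 0 ≤ homVec S y i := fun i => by
      cases i with
      | none => exact zero_le_one
      | some i => exact hy.fullVec_nonneg hS i
    exact mul_nonneg (h i) (h j)

end Lifting

end ACUC

/-! ### Weak duality -/

namespace ACUC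

section WeakDuality

variable {N G : Type*} [Fintype N] [DecidableEq N] [Fintype G] [DecidableEq G] {n : ℕ}
  {P : ACUC N G n} {S : Finset (Quantity G n)} {U : Cont G n S → ℝ}

/-- Cauchy–Schwarz in the plane; the defect is `(p₀ * q - q₀ * p) ^ 2`. -/
theorem thermal_pairing_ge {s p q s₀ p₀ q₀ : ℝ} (h : √(p₀ ^ 2 + q₀ ^ 2) ≤ s₀)
    (h' : p ^ 2 + q ^ 2 ≤ s ^ 2) : -(s₀ * |s|) ≤ p₀ * p + q₀ * q := by
  have h1 : √(p ^ 2 + q ^ 2) ≤ |s| := Real.sqrt_le_iff.2 ⟨abs_nonneg s, by rwa [sq_abs]⟩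
  have h2 : (p₀ * p + q₀ * q) ^ 2 ≤ (√(p₀ ^ 2 + q₀ ^ 2) * √(p ^ 2 + q ^ 2)) ^ 2 := by
    rw [mul_pow, Real.sq_sqrt (by positivity), Real.sq_sqrt (by positivity)]
    nlinarith [sq_nonneg (p₀ * q - q₀ * p)]
  have h3 := abs_le_of_sq_le_sq h2 (by positivity)
  have h4 : √(p₀ ^ 2 + q₀ ^ 2) * √(p ^ 2 + q ^ 2) ≤ s₀ * |s| :=
    mul_le_mul h h1 (Real.sqrt_nonneg _) ((Real.sqrt_nonneg _).trans h)
  linarith [(abs_le.1 h3).1]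

/-- Stationarity writes the cost as the pairing. Equations contribute equally to both sides, and
each inequality or cone term has a favourable sign. -/
theorem DualFeasible.value_le_cost {m : P.Mult S} (hm : P.DualFeasible S m) {w : P.Lift S}
    (hw : P.SDPFeasible S U w) : m.value U ≤ w.cost := by
  rw [hm.stationary w (fun t => (hw.W_psd t).isSymm) hw.Y_psd.isSymm]
  have hth : -∑ a : P.Arc, ∑ t, m.th0 a t * |P.Smax a.1.1 a.1.2| ≤
      ∑ a, ∑ t, (m.thP a t * w.pf a t + m.thQ a t * w.qf a t) := by
    simp only [← Finset.sum_neg_distrib]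
    exact Finset.sum_le_sum fun a _ => Finset.sum_le_sum fun t _ =>
      thermal_pairing_ge (hm.thermal a t) (hw.thermal a t)
  have hvolt : ∑ k, ∑ t, (m.vmin k t * P.Vmin k ^ 2 + m.vmax k t * P.Vmax k ^ 2) ≤
      ∑ k, ∑ t, (m.vmin k t * w.sq k t + m.vmax k t * w.sq k t) :=
    Finset.sum_le_sum fun k _ => Finset.sum_le_sum fun t _ => add_le_add
      (mul_le_mul_of_nonneg_left (hw.volt_min k t) (hm.vmin k t))
      (mul_le_mul_of_nonpos_left (hw.volt_max k t) (hm.vmax k t))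
  have hbound : ∑ i, m.phi i * U i ^ 2 ≤ ∑ i, m.phi i * w.X (.inr i) (.inr i) :=
    Finset.sum_le_sum fun i _ => mul_le_mul_of_nonpos_left (hw.bound i) (hm.phi i)
  have hPsi : 0 ≤ ∑ t, (m.Psi t * w.W t).trace :=
    Finset.sum_nonneg fun t _ => (hm.Psi_psd t).trace_mul_nonneg (hw.W_psd t)
  have hOmega := hm.Omega_psd.trace_mul_nonneg hw.Y_psd
  have hTheta := Matrix.trace_mul_nonneg_of_nonneg hm.Theta_nonneg hw.Y_nonneg
  simp only [Mult.value, Mult.pairing, hw.pFwd, hw.qFwd, hw.pRev, hw.qRev, hw.loss, hw.balance_re,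
    hw.balance_im, hw.row, hw.agg_sq, hw.row_sq, hw.bin, hw.corner, sub_self, mul_zero, add_zero,
    zero_add, mul_one, Finset.sum_const_zero]
  linarith

end WeakDuality

/-! ### The relaxation as a conic program -/

section ConicForm

variable {N G : Type*} [Fintype N] [DecidableEq N] [Fintype G] [DecidableEq G] {n : ℕ}
  (P : ACUC N G n) (S : Finset (Quantity G n)) (U : Cont G n S → ℝ)

/-- The normed space of the variables of the relaxation. -/
abbrev LiftSpace : Type _ :=
  (P.Arc → Fin (n + 1) → ℝ) × (P.Arc → Fin (n + 1) → ℝ) ×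
    (Fin (n + 1) → N ⊕ N → N ⊕ N → ℝ) × (Option (Idx G n S) → Option (Idx G n S) → ℝ)

/-- The target space of the equations. -/
abbrev EqSpace : Type _ :=
  (P.L → Fin (n + 1) → ℝ) × (P.L → Fin (n + 1) → ℝ) × (P.L → Fin (n + 1) → ℝ) ×
    (P.L → Fin (n + 1) → ℝ) × (Fin (n + 1) → ℝ) × (N → Fin (n + 1) → ℝ) × (N → Fin (n + 1) → ℝ) ×
    (Row G n → ℝ) × (Row G n → ℝ) × (Fin (n + 1) → ℝ) × (Bin G n → ℝ) × ℝ

/-- The target space of the thermal limits. -/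
abbrev ThermalSpace : Type _ :=
  (P.Arc → Fin (n + 1) → ℝ) × (P.Arc → Fin (n + 1) → ℝ) × (P.Arc → Fin (n + 1) → ℝ)

/-- The target space of all constraints. -/
abbrev ConSpace : Type _ :=
  P.EqSpace × P.ThermalSpace × (N → Fin (n + 1) → ℝ) × (N → Fin (n + 1) → ℝ) ×
    (Cont G n S → ℝ) × (Fin (n + 1) → N ⊕ N → N ⊕ N → ℝ) ×
    (Option (Idx G n S) → Option (Idx G n S) → ℝ) × (Option (Idx G n S) → Option (Idx G n S) → ℝ)

variable {P S}

/-- The variables of the relaxation with a given tuple of values. -/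
def ofTuple (e : P.LiftSpace S) : P.Lift S where
  pf := e.1
  qf := e.2.1
  W t := Matrix.of (e.2.2.1 t)
  Y := Matrix.of e.2.2.2

/-- The values of the equations. -/
def eqMap (w : P.Lift S) : P.EqSpace :=
  (w.pFwd, w.qFwd, w.pRev, w.qRev, w.lossGap, w.netP, w.netQ, fun r => P.rowVec S r ⬝ᵥ w.x,
    fun r => w.quad (P.rowVec S r), fun t => w.quad (aggVec S t),
    fun i => w.x (.inl i) - w.X (.inl i) (.inl i), w.Y none none)

/-- The linear parts of all constraints. -/
def conMap (w : P.Lift S) : P.ConSpace S :=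
  (eqMap w, (0, w.pf, w.qf), w.sq, w.sq, fun i => w.X (.inr i) (.inr i), fun t i j => w.W t i j,
    fun i j => w.Y i j, fun i j => w.Y i j)

variable (P S)

/-- The right-hand sides of the equations. -/
def eqRhs : P.EqSpace :=
  (0, 0, 0, 0, 0, fun k t => (P.demand k t).re, fun k t => (P.demand k t).im, rowRhs,
    fun r => rowRhs r ^ 2, fun t => P.aggRhs t ^ 2, 0, 1)

/-- The right-hand sides of all constraints. -/
def conRhs : P.ConSpace S :=
  (P.eqRhs, (fun a _ => -|P.Smax a.1.1 a.1.2|, 0, 0), fun k _ => P.Vmin k ^ 2,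
    fun k _ => P.Vmax k ^ 2, fun i => U i ^ 2, 0, 0, 0)

/-- The product of second-order cones of the thermal limits. -/
def thermalCone : Set P.ThermalSpace :=
  { a | ∀ i : P.Arc × Fin (n + 1),
    (a.1 i.1 i.2, a.2.1 i.1 i.2, a.2.2 i.1 i.2) ∈ {a : ℝ × ℝ × ℝ | ‖(⟨a.2.1, a.2.2⟩ : ℂ)‖ ≤ a.1} }

/-- The cone of all constraints. -/
def conCone : Set (P.ConSpace S) :=
  {0} ×ˢ P.thermalCone ×ˢ {a | ∀ k, a k ∈ {b | ∀ t, b t ∈ {c : ℝ | 0 ≤ c}}} ×ˢ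
    {a | ∀ k, a k ∈ {b | ∀ t, b t ∈ {c : ℝ | c ≤ 0}}} ×ˢ {a | ∀ i, a i ∈ {c : ℝ | c ≤ 0}} ×ˢ
    {a | ∀ t, a t ∈ {b | (Matrix.of b).PosSemidef}} ×ˢ {b | (Matrix.of b).PosSemidef} ×ˢ
    {a | ∀ i, a i ∈ {b | ∀ j, b j ∈ {c : ℝ | 0 ≤ c}}}

omit [Fintype N] [Fintype G] [DecidableEq G] in
theorem isClosedCone_thermalCone : IsClosedCone P.thermalCone :=
  let π (i : P.Arc × Fin (n + 1)) : (P.Arc → Fin (n + 1) → ℝ) →L[ℝ] ℝ :=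
    (ContinuousLinearMap.proj (R := ℝ) (φ := fun _ : Fin (n + 1) => ℝ) i.2).comp
      (ContinuousLinearMap.proj (R := ℝ) (φ := fun _ : P.Arc => Fin (n + 1) → ℝ) i.1)
  IsClosedCone.forall_mem (fun _ => IsClosedCone.secondOrder) fun i =>
    (π i).prodMap ((π i).prodMap (π i))

omit [DecidableEq G] in
theorem isClosedCone_conCone : IsClosedCone (P.conCone S) :=
  IsClosedCone.singleton_zero.prod <| P.isClosedCone_thermalCone.prod <|
    IsClosedCone.nonneg.pi.pi.prod <| IsClosedCone.nonpos.pi.pi.prod <|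
    IsClosedCone.nonpos.pi.prod <| IsClosedCone.posSemidef.pi.prod <|
    IsClosedCone.posSemidef.prod IsClosedCone.nonneg.pi.pi

variable {P S}

omit [Fintype N] [Fintype G] [DecidableEq G] in
theorem mem_thermalCone {a : P.ThermalSpace} :
    a ∈ P.thermalCone ↔ ∀ i t, √(a.2.1 i t ^ 2 + a.2.2 i t ^ 2) ≤ a.1 i t := by
  simp only [thermalCone, Set.mem_ofPred_eq, Prod.forall, Complex.norm_def, Complex.normSq_mk, sq]

omit [Fintype N] [Fintype G] [DecidableEq G] in
theorem mem_conCone {a : P.ConSpace S} : a ∈ P.conCone S ↔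
    a.1 = 0 ∧ a.2.1 ∈ P.thermalCone ∧ (∀ k t, 0 ≤ a.2.2.1 k t) ∧ (∀ k t, a.2.2.2.1 k t ≤ 0) ∧
    (∀ i, a.2.2.2.2.1 i ≤ 0) ∧ (∀ t, (Matrix.of (a.2.2.2.2.2.1 t)).PosSemidef) ∧
    (Matrix.of a.2.2.2.2.2.2.1).PosSemidef ∧ ∀ i j, 0 ≤ a.2.2.2.2.2.2.2 i j :=
  Iff.rfl

/-- The thermal limit becomes conic by taking square roots: the leading entry `|Smax|` is constant,
hence `0` in `conMap` and `-|Smax|` in `conRhs`. Voltages and `Y` occur twice in `conMap`, once for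
each of their two constraints. -/
theorem sdpFeasible_iff (w : P.Lift S) :
    P.SDPFeasible S U w ↔ conMap w - P.conRhs S U ∈ P.conCone S := by
  have hth : (∀ (a : P.Arc) t, w.pf a t ^ 2 + w.qf a t ^ 2 ≤ P.Smax a.1.1 a.1.2 ^ 2) ↔
      ∀ (a : P.Arc) t, √(w.pf a t ^ 2 + w.qf a t ^ 2) ≤ |P.Smax a.1.1 a.1.2| := by
    refine forall₂_congr fun a t => ?_
    rw [Real.sqrt_le_left (abs_nonneg _), sq_abs]
  rw [mem_conCone, mem_thermalCone]
  simp only [conMap, conRhs, eqMap, eqRhs, Prod.mk_sub_mk, Prod.mk_eq_zero, funext_iff,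
    Pi.sub_apply, Pi.neg_apply, Pi.zero_apply, sub_zero, zero_sub, neg_neg, sub_eq_zero, sub_nonneg, sub_nonpos,
    ← hth]
  constructor
  · intro h
    exact ⟨⟨h.pFwd, h.qFwd, h.pRev, h.qRev, h.loss, h.balance_re, h.balance_im, h.row, h.row_sq,
      h.agg_sq, h.bin, h.corner⟩, h.thermal, h.volt_min, h.volt_max, h.bound, h.W_psd, h.Y_psd,
      h.Y_nonneg⟩
  · rintro ⟨⟨h1, h2, h3, h4, h5, h6, h7, h8, h9, h10, h11, h12⟩, h13, h14, h15, h16, h17, h18, h19⟩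
    exact ⟨h13, h1, h2, h3, h4, h14, h15, h17, h5, h6, h7, h8, h10, h9, h11, h16, h12, h18, h19⟩

/-- This is where boundedness enters: every variable is controlled by a second-order cone constraint
or by the trace of a semidefinite matrix, and a positive semidefinite matrix of nonpositive trace is
zero. -/
theorem eq_zero_of_conMap_mem {e : P.LiftSpace S} (h : conMap (ofTuple e) ∈ P.conCone S) :
    e = 0 := by
  obtain ⟨pf, qf, W, Y⟩ := e
  rw [mem_conCone, mem_thermalCone] at h
  obtain ⟨h0, hth, -, hv, hphi, hW, hY, -⟩ := h
  simp only [conMap, eqMap, Prod.mk_eq_zero, funext_iff, Pi.zero_apply] at h0 hth hv hphi hW hY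
  obtain ⟨-, -, -, -, -, -, -, -, -, -, hbin, hcorner⟩ := h0
  have hpq : ∀ a t, pf a t = 0 ∧ qf a t = 0 := fun a t => by
    have h1 := Real.sqrt_eq_zero'.1 ((hth a t).antisymm (Real.sqrt_nonneg _))
    simp only [ofTuple] at h1
    constructor <;> nlinarith [sq_nonneg (pf a t), sq_nonneg (qf a t)]
  have hW0 : ∀ t, Matrix.of (W t) = 0 := fun t => by
    have h1 : (Matrix.of (W t)).PosSemidef := hW t
    refine h1.trace_eq_zero_iff.1 (le_antisymm ?_ h1.trace_nonneg)
    rw [Matrix.trace, Fintype.sum_sum_type, ← Finset.sum_add_distrib]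
    exact Finset.sum_nonpos fun k _ => hv k t
  have hY0 : Matrix.of Y = 0 := by
    have h1 : (Matrix.of Y).PosSemidef := hY
    have hc : Y none none = 0 := hcorner
    -- With zero corner, the quadratic form at the vector with entries `s` and `1` is `X_ii + 2 * s
    -- * x_i`, nonnegative for every `s`.
    have hx : ∀ i, Y (some i) none = 0 := fun i => by
      have h2 : 0 ≤ Y (some i) (some i) := h1.diag_nonneg (i := some i)
      have h3 := fun s : ℝ => h1.dotProduct_mulVec_nonneg
        (fun j => if j = some i then 1 else if j = none then s else 0)
      have h4 : Y none (some i) = Y (some i) none := h1.isSymm.apply (some i) none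
      simp only [dotProduct, Matrix.mulVec, Fintype.sum_option, Pi.star_apply, star_trivial,
        Matrix.of_apply, hc] at h3
      simp [h4] at h3
      by_contra hne
      -- This `s` makes the form equal to `-1`.
      have h5 := h3 (-(Y (some i) (some i) + 1) / (2 * Y (some i) none))
      field_simp at h5
      linarith
    refine h1.trace_eq_zero_iff.1 (le_antisymm ?_ h1.trace_nonneg)
    rw [Matrix.trace, Fintype.sum_option, Fintype.sum_sum_type]
    have h2 : ∀ i, Y (some (.inl i)) (some (.inl i)) = 0 := fun i =>
      (sub_eq_zero.1 (hbin i)).symm.trans (hx _)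
    have h3 : ∀ i, Y (some (.inr i)) (some (.inr i)) ≤ 0 := hphi
    simp only [Matrix.diag, Matrix.of_apply, hc, h2, Finset.sum_const_zero, zero_add]
    exact Finset.sum_nonpos fun i _ => h3 i
  refine Prod.ext ?_ (Prod.ext ?_ (Prod.ext ?_ ?_))
  · exact funext₂ fun a t => (hpq a t).1
  · exact funext₂ fun a t => (hpq a t).2
  · exact funext hW0
  · exact hY0

end ConicForm

end ACUC

/-! ### From functionals to multipliers -/

namespace ACUC

section Multipliers

theorem nonneg_of_forall_sum_nonneg {ι : Type*} [Fintype ι] {c : ι → ℝ}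
    (h : ∀ a : ι → ℝ, (∀ i, 0 ≤ a i) → 0 ≤ ∑ i, c i * a i) (i : ι) : 0 ≤ c i := by
  classical
  have := h (fun j => if j = i then 1 else 0) fun j => by split_ifs <;> simp
  simpa using this

theorem nonneg_of_forall_sum_sum_nonneg {ι κ : Type*} [Fintype ι] [Fintype κ] {c : ι → κ → ℝ}
    (h : ∀ a : ι → κ → ℝ, (∀ i j, 0 ≤ a i j) → 0 ≤ ∑ i, ∑ j, c i j * a i j) (i : ι) (j : κ) :
    0 ≤ c i j := by
  classical
  refine nonneg_of_forall_sum_nonneg (c := c i) (fun b hb => ?_) j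
  have := h (fun i' => if i' = i then b else 0) fun i' j' => by
    split_ifs
    · exact hb j'
    · exact le_rfl
  rwa [Finset.sum_eq_single i (fun i' _ hi' => by simp [hi']) (by simp), if_pos rfl] at this

/-- Self-duality of the second-order cone. Testing with `(r, -c₁, -c₂)` in one coordinate, `r` being
the norm of `(c₁, c₂)`, gives `r * r ≤ c₀ * r`; if `r = 0`, only `0 ≤ c₀` is needed. -/
theorem thermal_of_forall_sum_nonneg {ι κ : Type*} [Fintype ι] [Fintype κ]
    {c₀ c₁ c₂ : ι → κ → ℝ}
    (h : ∀ s p q : ι → κ → ℝ, (∀ i j, √(p i j ^ 2 + q i j ^ 2) ≤ s i j) →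
      0 ≤ ∑ i, ∑ j, c₀ i j * s i j + (∑ i, ∑ j, c₁ i j * p i j + ∑ i, ∑ j, c₂ i j * q i j))
    (i : ι) (j : κ) : √(c₁ i j ^ 2 + c₂ i j ^ 2) ≤ c₀ i j := by
  classical
  have hc : 0 ≤ c₀ i j := nonneg_of_forall_sum_sum_nonneg (fun a ha => by
    simpa using h a 0 0 (by simpa using ha)) i j
  set r := √(c₁ i j ^ 2 + c₂ i j ^ 2) with hr
  have hr2 : r ^ 2 = c₁ i j ^ 2 + c₂ i j ^ 2 := Real.sq_sqrt (by positivity)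
  have h1 := h (fun i' j' => if i' = i ∧ j' = j then r else 0)
    (fun i' j' => if i' = i ∧ j' = j then -c₁ i j else 0)
    (fun i' j' => if i' = i ∧ j' = j then -c₂ i j else 0) (fun i' j' => by
      split_ifs <;> simp [hr])
  simp only [ite_and, mul_ite, mul_zero, Finset.sum_ite_irrel, Finset.sum_const_zero,
    Finset.sum_ite_eq', Finset.mem_univ, if_true] at h1
  have h2 : r * r ≤ c₀ i j * r := by nlinarith
  rcases (Real.sqrt_nonneg (c₁ i j ^ 2 + c₂ i j ^ 2)).eq_or_lt with h0 | h0
  · rw [hr, ← h0]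
    exact hc
  · exact le_of_mul_le_mul_right h2 h0

variable {N G : Type*} [Fintype N] [DecidableEq N] [Fintype G] [DecidableEq G] {n : ℕ}
  {P : ACUC N G n} {S : Finset (Quantity G n)} {U : Cont G n S → ℝ}

/-- A functional on the constraint space is the pairing with a multiplier, and if it is nonnegative
on the cone and represents the objective, then that multiplier is dual feasible. -/
theorem exists_dualFeasible (f : P.ConSpace S →ₗ[ℝ] ℝ) (hf : ∀ k ∈ P.conCone S, 0 ≤ f k)
    (hcost : ∀ w : P.Lift S, w.cost = f (conMap w)) :
    ∃ m : P.Mult S, P.DualFeasible S m ∧ m.value U = f (P.conRhs S U) := by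
  obtain ⟨fE, f, hE⟩ := f.exists_eq_add_of_prod
  obtain ⟨fT, f, hT⟩ := f.exists_eq_add_of_prod
  obtain ⟨fmin, f, hmin⟩ := f.exists_eq_add_of_prod
  obtain ⟨fmax, f, hmax⟩ := f.exists_eq_add_of_prod
  obtain ⟨fphi, f, hphi⟩ := f.exists_eq_add_of_prod
  obtain ⟨fPsi, f, hPsi⟩ := f.exists_eq_add_of_prod
  obtain ⟨fOmega, fTheta, hOT⟩ := f.exists_eq_add_of_prod
  obtain ⟨th0, fT, hT0⟩ := fT.exists_eq_add_of_prod
  obtain ⟨thP, thQ, hT1⟩ := fT.exists_eq_add_of_prod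
  obtain ⟨e1, fE, hE1⟩ := fE.exists_eq_add_of_prod
  obtain ⟨e2, fE, hE2⟩ := fE.exists_eq_add_of_prod
  obtain ⟨e3, fE, hE3⟩ := fE.exists_eq_add_of_prod
  obtain ⟨e4, fE, hE4⟩ := fE.exists_eq_add_of_prod
  obtain ⟨e5, fE, hE5⟩ := fE.exists_eq_add_of_prod
  obtain ⟨e6, fE, hE6⟩ := fE.exists_eq_add_of_prod
  obtain ⟨e7, fE, hE7⟩ := fE.exists_eq_add_of_prod
  obtain ⟨e8, fE, hE8⟩ := fE.exists_eq_add_of_prod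
  obtain ⟨e9, fE, hE9⟩ := fE.exists_eq_add_of_prod
  obtain ⟨e10, fE, hE10⟩ := fE.exists_eq_add_of_prod
  obtain ⟨e11, e12, hE11⟩ := fE.exists_eq_add_of_prod
  obtain ⟨c0, hc0⟩ := th0.exists_coeff₂
  obtain ⟨cP, hcP⟩ := thP.exists_coeff₂
  obtain ⟨cQ, hcQ⟩ := thQ.exists_coeff₂
  obtain ⟨cmin, hcmin⟩ := fmin.exists_coeff₂
  obtain ⟨cmax, hcmax⟩ := fmax.exists_coeff₂
  obtain ⟨cphi, hcphi⟩ := fphi.exists_coeff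
  obtain ⟨cPsi, hcPsi⟩ := fPsi.exists_coeff₃
  obtain ⟨cOmega, hcOmega⟩ := fOmega.exists_coeff₂
  obtain ⟨cTheta, hcTheta⟩ := fTheta.exists_coeff₂
  obtain ⟨c1, hc1⟩ := e1.exists_coeff₂
  obtain ⟨c2, hc2⟩ := e2.exists_coeff₂
  obtain ⟨c3, hc3⟩ := e3.exists_coeff₂
  obtain ⟨c4, hc4⟩ := e4.exists_coeff₂
  obtain ⟨c5, hc5⟩ := e5.exists_coeff
  obtain ⟨c6, hc6⟩ := e6.exists_coeff₂
  obtain ⟨c7, hc7⟩ := e7.exists_coeff₂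
  obtain ⟨c8, hc8⟩ := e8.exists_coeff
  obtain ⟨c9, hc9⟩ := e9.exists_coeff
  obtain ⟨c10, hc10⟩ := e10.exists_coeff
  obtain ⟨c11, hc11⟩ := e11.exists_coeff
  -- A functional on `ℝ` is multiplication by its value at `1`, which becomes `mu`.
  have hc12 : ∀ r, e12 r = e12 1 * r := fun r => by
    rw [mul_comm, ← smul_eq_mul, ← map_smul, smul_eq_mul, mul_one]
  simp only [hE, hT, hmin, hmax, hphi, hPsi, hOT, hT0, hT1, hE1, hE2, hE3, hE4, hE5, hE6, hE7, hE8,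
    hE9, hE10, hE11, conMap, eqMap, conRhs, eqRhs, map_zero] at hcost ⊢
  -- The equation block of the cone is `{0}`, so its multipliers stay free and drop out of the sign
  -- conditions. Each sign condition below tests one block, with zeros in the others.
  have hcone : ∀ x0 xP xQ xmin xmax xphi xPsi xOmega xTheta,
      (∀ i t, √(xP i t ^ 2 + xQ i t ^ 2) ≤ x0 i t) → (∀ k t, 0 ≤ xmin k t) →
      (∀ k t, xmax k t ≤ 0) → (∀ i, xphi i ≤ 0) → (∀ t, (Matrix.of (xPsi t)).PosSemidef) →
      (Matrix.of xOmega).PosSemidef → (∀ i j, 0 ≤ xTheta i j) →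
      0 ≤ (th0 x0 + (thP xP + thQ xQ)) + (fmin xmin + (fmax xmax + (fphi xphi + (fPsi xPsi +
        (fOmega xOmega + fTheta xTheta))))) := by
    intro x0 xP xQ xmin xmax xphi xPsi xOmega xTheta h1 h2 h3 h4 h5 h6 h7
    have := hf (0, (x0, xP, xQ), xmin, xmax, xphi, xPsi, xOmega, xTheta)
      (mem_conCone.2 ⟨rfl, mem_thermalCone.2 h1, h2, h3, h4, h5, h6, h7⟩)
    simpa only [hE, map_zero, zero_add, hT, hmin, hmax, hphi, hPsi, hOT, hT0, hT1] using this
  clear hE hT hmin hmax hphi hPsi hOT hT0 hT1 hE1 hE2 hE3 hE4 hE5 hE6 hE7 hE8 hE9 hE10 hE11 hf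
  simp only [hc0, hcP, hcQ, hcmin, hcmax, hcphi, hcPsi, hcOmega, hcTheta, hc1, hc2, hc3, hc4, hc5,
    hc6, hc7, hc8, hc9, hc10, hc11] at hcost ⊢ hcone
  refine ⟨{ pFwd := c1, qFwd := c2, pRev := c3, qRev := c4, th0 := c0, thP := cP, thQ := cQ,
            vmin := cmin, vmax := cmax, Psi := fun t => Matrix.symmPart (cPsi t), loss := c5,
            lamR := c6, lamI := c7, gamma := c8, omega := c9, lamHat := c10, kappa := c11,
            phi := cphi, mu := e12 1, Omega := Matrix.symmPart cOmega,
            Theta := Matrix.symmPart cTheta }, ⟨?_, ?_, ?_, ?_, ?_, ?_, ?_, ?_, ?_⟩, ?_⟩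
  · refine thermal_of_forall_sum_nonneg fun s p q h => ?_
    simpa using hcone s p q 0 0 0 0 0 0 h (by simp) (by simp) (by simp)
      (fun _ => Matrix.PosSemidef.zero) Matrix.PosSemidef.zero (by simp)
  · refine nonneg_of_forall_sum_sum_nonneg fun a h => ?_
    simpa using hcone 0 0 0 a 0 0 0 0 0 (by simp) h (by simp) (by simp)
      (fun _ => Matrix.PosSemidef.zero) Matrix.PosSemidef.zero (by simp)
  · refine fun k t => neg_nonneg.1 <| nonneg_of_forall_sum_sum_nonneg
      (c := fun k t => -cmax k t) (fun a h => ?_) k t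
    simpa using hcone 0 0 0 0 (-a) 0 0 0 0 (by simp) (by simp) (by simpa using h) (by simp)
      (fun _ => Matrix.PosSemidef.zero) Matrix.PosSemidef.zero (by simp)
  · refine fun t => Matrix.symmPart_posSemidef fun A hA => ?_
    have := hcone 0 0 0 0 0 0 (fun t' i j => if t' = t then A i j else 0) 0 0 (by simp) (by simp) (by simp)
      (by simp) (fun t' => by
        by_cases ht : t' = t
        · simp only [ht, if_true]
          exact hA
        · simp only [ht, if_false]
          exact Matrix.PosSemidef.zero) Matrix.PosSemidef.zero (by simp)
    simp only [Pi.zero_apply, mul_zero, Finset.sum_const_zero, zero_add, add_zero] at this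
    rw [Finset.sum_eq_single t (fun t' _ ht' => by simp [ht']) (by simp)] at this
    simpa only [if_true] using this
  · refine fun i => neg_nonneg.1 <| nonneg_of_forall_sum_nonneg
      (c := fun i => -cphi i) (fun a h => ?_) i
    simpa using hcone 0 0 0 0 0 (-a) 0 0 0 (by simp) (by simp) (by simp) (by simpa using h)
      (fun _ => Matrix.PosSemidef.zero) Matrix.PosSemidef.zero (by simp)
  · refine Matrix.symmPart_posSemidef fun A hA => ?_
    simpa using hcone 0 0 0 0 0 0 0 A 0 (by simp) (by simp) (by simp) (by simp)
      (fun _ => Matrix.PosSemidef.zero) hA (by simp)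
  · exact Matrix.symmPart_isSymm cTheta
  · refine Matrix.symmPart_nonneg (nonneg_of_forall_sum_sum_nonneg fun a h => ?_)
    simpa using hcone 0 0 0 0 0 0 0 0 a (by simp) (by simp) (by simp) (by simp)
      (fun _ => Matrix.PosSemidef.zero) Matrix.PosSemidef.zero h
  -- Symmetry of `W t` and `Y` makes the symmetrized multipliers pair as the original coefficients
  -- do.
  · intro w hW hY
    rw [hcost, hc12]
    simp only [Mult.pairing, Matrix.trace_symmPart_mul _ (hW _), Matrix.trace_symmPart_mul _ hY,
      Finset.sum_add_distrib]
    ring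
  · simp only [Mult.value, Finset.sum_add_distrib, mul_neg, Finset.sum_neg_distrib]
    ring

end Multipliers

/-! ### Linearity of the constraints and strong duality -/

section Main

variable {N G : Type*} [Fintype N] [DecidableEq N] [Fintype G] [DecidableEq G] {n : ℕ}
  (P : ACUC N G n) (S : Finset (Quantity G n)) (U : Cont G n S → ℝ)

/-- The objective as a linear map. -/
noncomputable def costLinear : P.LiftSpace S →ₗ[ℝ] ℝ where
  toFun e := (ofTuple e).cost
  map_add' e e' := by
    simp only [Lift.cost, costOf, Lift.x, ofTuple, Matrix.of_apply, Prod.snd_add, Pi.add_apply,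
      ← Finset.sum_add_distrib]
    refine Finset.sum_congr rfl fun g _ => Finset.sum_congr rfl fun t _ => ?_
    ring
  map_smul' r e := by
    simp only [Lift.cost, costOf, Lift.x, ofTuple, Matrix.of_apply, Prod.smul_snd, Pi.smul_apply,
      smul_eq_mul, RingHom.id_apply, Finset.mul_sum]
    refine Finset.sum_congr rfl fun g _ => Finset.sum_congr rfl fun t _ => ?_
    ring

variable {P S}

omit [Fintype N] [Fintype G] [DecidableEq G] in
theorem ofTuple_x_add (e e' : P.LiftSpace S) :
    (ofTuple (e + e')).x = (ofTuple e).x + (ofTuple e').x := rfl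

omit [Fintype N] [Fintype G] [DecidableEq G] in
theorem ofTuple_X_add (e e' : P.LiftSpace S) :
    (ofTuple (e + e')).X = (ofTuple e).X + (ofTuple e').X := rfl

omit [Fintype N] [Fintype G] [DecidableEq G] in
theorem ofTuple_x_smul (r : ℝ) (e : P.LiftSpace S) :
    (ofTuple (r • e)).x = r • (ofTuple e).x := rfl

omit [Fintype N] [Fintype G] [DecidableEq G] in
theorem ofTuple_X_smul (r : ℝ) (e : P.LiftSpace S) :
    (ofTuple (r • e)).X = r • (ofTuple e).X := rfl

omit [Fintype N] [Fintype G] [DecidableEq G] in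
theorem ofTuple_pf_add (e e' : P.LiftSpace S) :
    (ofTuple (e + e')).pf = (ofTuple e).pf + (ofTuple e').pf := rfl

omit [Fintype N] [Fintype G] [DecidableEq G] in
theorem ofTuple_qf_add (e e' : P.LiftSpace S) :
    (ofTuple (e + e')).qf = (ofTuple e).qf + (ofTuple e').qf := rfl

omit [Fintype N] [Fintype G] [DecidableEq G] in
theorem ofTuple_pf_smul (r : ℝ) (e : P.LiftSpace S) :
    (ofTuple (r • e)).pf = r • (ofTuple e).pf := rfl

omit [Fintype N] [Fintype G] [DecidableEq G] in
theorem ofTuple_qf_smul (r : ℝ) (e : P.LiftSpace S) :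
    (ofTuple (r • e)).qf = r • (ofTuple e).qf := rfl

omit [Fintype N] [Fintype G] [DecidableEq G] in
theorem ofTuple_W_add (e e' : P.LiftSpace S) :
    (ofTuple (e + e')).W = (ofTuple e).W + (ofTuple e').W := rfl

omit [Fintype N] [Fintype G] [DecidableEq G] in
theorem ofTuple_W_smul (r : ℝ) (e : P.LiftSpace S) :
    (ofTuple (r • e)).W = r • (ofTuple e).W := rfl

omit [Fintype N] [Fintype G] [DecidableEq G] in
theorem ofTuple_Y_add (e e' : P.LiftSpace S) :
    (ofTuple (e + e')).Y = (ofTuple e).Y + (ofTuple e').Y := rfl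

omit [Fintype N] [Fintype G] [DecidableEq G] in
theorem ofTuple_Y_smul (r : ℝ) (e : P.LiftSpace S) :
    (ofTuple (r • e)).Y = r • (ofTuple e).Y := rfl

variable (P S)

set_option synthInstance.maxHeartbeats 100000 in
set_option synthInstance.maxSize 1000 in
omit [Fintype N] [Fintype G] [DecidableEq G] in
theorem continuousSMul_conSpace : ContinuousSMul ℝ (P.ConSpace S) := inferInstance

set_option synthInstance.maxHeartbeats 100000 in
set_option synthInstance.maxSize 1000 in
omit [DecidableEq G] in
theorem finiteDimensional_conSpace : FiniteDimensional ℝ (P.ConSpace S) := inferInstance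

/-- The linear parts of all constraints as a linear map. -/
noncomputable def conLinear : P.LiftSpace S →ₗ[ℝ] P.ConSpace S where
  toFun e := conMap (ofTuple e)
  map_add' e e' := by
    simp only [conMap, eqMap, Prod.mk_add_mk, Prod.mk.injEq, funext_iff, Lift.pFwd, Lift.qFwd,
      Lift.pRev, Lift.qRev, Lift.sq, Lift.re, Lift.im, Lift.lossGap, Lift.netP, Lift.netQ,
      Lift.quad, ofTuple_x_add, ofTuple_X_add, ofTuple_pf_add, ofTuple_qf_add, ofTuple_W_add,
      ofTuple_Y_add, Pi.add_apply, Matrix.add_apply, dotProduct_add, Matrix.mul_add,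
      Matrix.trace_add, Finset.sum_add_distrib, add_zero, implies_true, and_true,
      true_and]
    refine ⟨⟨?_, ?_, ?_, ?_, ?_, ?_, ?_, ?_⟩, ?_, ?_⟩ <;> intros <;> ring
  map_smul' r e := by
    simp only [conMap, eqMap, Prod.smul_mk, Prod.mk.injEq, funext_iff, Lift.pFwd, Lift.qFwd,
      Lift.pRev, Lift.qRev, Lift.sq, Lift.re, Lift.im, Lift.lossGap, Lift.netP, Lift.netQ,
      Lift.quad, ofTuple_x_smul, ofTuple_X_smul, ofTuple_pf_smul, ofTuple_qf_smul, ofTuple_W_smul,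
      ofTuple_Y_smul, Pi.smul_apply, Matrix.smul_apply, dotProduct_smul, Matrix.mul_smul,
      Matrix.trace_smul, ← Finset.mul_sum, smul_eq_mul, RingHom.id_apply, Pi.zero_apply, mul_zero,
      implies_true, and_true, true_and]
    refine ⟨⟨?_, ?_, ?_, ?_, ?_, ?_, ?_, ?_⟩, ?_, ?_⟩ <;> intros <;> ring

end Main

end ACUC

set_option maxRecDepth 2000 in
theorem proposition5 {N G : Type*} [Fintype N] [DecidableEq N] [Fintype G] [DecidableEq G] {n : ℕ}
    (P : ACUC N G n) (S : Finset (ACUC.Quantity G n)) (U : ACUC.Cont G n S → ℝ)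
    (hV : ∀ k, 0 ≤ P.Vmin k)
    (hS : P.NonnegOutside S)
    (hU : P.BoundedBy S U)
    (hfeas : ∃ y, P.Feasible y) :
    P.StrongDuality S U := by
  obtain ⟨y, hy⟩ := hfeas
  have hto : ∀ w : P.Lift S, ∃ e : P.LiftSpace S, ACUC.ofTuple e = w := fun w =>
    ⟨(w.pf, w.qf, fun t i j => w.W t i j, fun i j => w.Y i j), rfl⟩
  obtain ⟨e₀, he₀⟩ := hto (ACUC.lift S y)
  have := P.continuousSMul_conSpace S
  have := P.finiteDimensional_conSpace S
  have hconic := IsClosedCone.exists_isLeast_and_dual (E := P.LiftSpace S) (F := P.ConSpace S)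
    (P.isClosedCone_conCone S) (P.conLinear S) (P.costLinear S) (P.conRhs S U)
    (fun w hw => ACUC.eq_zero_of_conMap_mem hw)
  obtain ⟨V, hleast, hdual⟩ := hconic
    ⟨e₀, (ACUC.sdpFeasible_iff U (ACUC.ofTuple e₀)).1 (by rw [he₀]; exact hy.lift hV hS hU)⟩
  have himage : (P.costLinear S) ''
      {w | (P.conLinear S) w - P.conRhs S U ∈ P.conCone S} =
      P.primalValues S U := by
    ext c
    constructor
    · rintro ⟨e, he, rfl⟩
      exact ⟨ACUC.ofTuple e, (ACUC.sdpFeasible_iff U _).2 he, rfl⟩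
    · rintro ⟨w, hw, rfl⟩
      obtain ⟨e, rfl⟩ := hto w
      exact ⟨e, (ACUC.sdpFeasible_iff U _).1 hw, rfl⟩
  rw [himage] at hleast
  refine ⟨V, hleast, ?_, fun b hb => ?_⟩
  · rintro _ ⟨m, hm, rfl⟩
    obtain ⟨w, hw, rfl⟩ := hleast.1
    exact hm.value_le_cost hw
  -- Dual values exceed every `d < V`, so no upper bound lies below `V`. As such `d` exist, this
  -- also shows that the dual is feasible.
  · refine le_of_forall_lt fun d hd => ?_
    obtain ⟨f, hfK, hst, hfb⟩ := hdual d hd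
    obtain ⟨m, hm, hval⟩ := ACUC.exists_dualFeasible (U := U) f hfK fun w => by
      obtain ⟨e, rfl⟩ := hto w
      exact hst e
    refine hfb.trans_le (le_trans hval.ge ?_)
    exact hb ⟨m, hm, rfl⟩
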